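/- A metrized graph $\Gamma$ with vertex set $V(\Gamma)$ is a finite connected graph with non-empty vertex set (loops and multiple edges allowed), each edge $e_i$ of which is identified with a segment $[0,L_i]$, $L_i>0$; $\Gamma$ also denotes the resulting compact topological space, with Lebesgue measure $dx$ along the edges. For a continuous $f:\Gamma\to\mathbb{R}$ that is $C^2$ off some finite set containing the vertices and has $f''\in L^1(\Gamma)$, put $$\Delta f=-f''\,dx-\sum_{p}\Big[\sum_{\vec v\text{ at }p}d_{\vec v}f(p)\Big]\delta_p ,$$ the inner sum being over the one-sided derivatives in all directions emanating from $p$. For $y,z\in\Gamma$ let $x\mapsto j_z(x,y)$ be the function of this class with $\Delta_x j_z(x,y)=\delta_y-\delta_z$ and $j_z(z,y)=0$. For a finite signed Borel measure $\mu$ on $\Gamma$ put $j_\mu(x,y)=\int_\Gamma j_\zeta(x,y)\,d\mu(\zeta)$. A canonical measure $\mu_{can}$ is a finite signed Borel measure $\mu$ with $\mu(\Gamma)=1$ for which $j_\mu(x,x)$ is constant in $x$, and the tau constant $\tau(\Gamma)$ is the constant value of $\frac12 j_\mu(x,x)$ for $\mu=\mu_{can}$. The vertex set is optimal if $\Gamma$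 has no self-loops and no multiple edges with respect to it. In that case let $v=\#V(\Gamma)$ and let $\mathrm{L}=(l_{pq})_{p,q\in V(\Gamma)}$ be the discrete Laplacian matrix: for $p\ne q$, $l_{pq}=-1/L_k$ if $p$ and $q$ are joined by an edge of length $L_k$ and $l_{pq}=0$ otherwise, and $l_{pp}=-\sum_{s\neq p}l_{ps}$. Let $\mathrm{L}^+=(l^+_{pq})$ be its Moore–Penrose pseudo-inverse. **Theorem.** Let $\Gamma$ be a metrized graph with an optimal vertex set $V(\Gamma)$ of size $v$ and edge set $E(\Gamma)$, and let $p_i,q_i$ be the end points of the edge $e_i$. Then a canonical measure exists, and $$\tau(\Gamma)=-\frac1{12}\sum_{e_i\in E(\Gamma)}l_{p_iq_i}\Big(\frac1{l_{p_iq_i}}+l^+_{p_ip_i}-2l^+_{p_iq_i}+l^+_{q_iq_i}\Big)^2+\frac14\sum_{q,s\in V(\Gamma)}l_{qs}\,l^+_{qq}\,l^+_{ss}+\frac1v\operatorname{tr}(\mathrm{L}^+),$$ $$\tau(\Gamma)=-\frac1{12}\sum_{e_i\in E(\Gamma)}l_{p_iq_i}\Big(\frac1{l_{p_iq_i}}+l^+_{p_ip_i}-2l^+_{p_iq_i}+l^+_{q_iq_i}\Big)^2-\frac14\sum_{e_i\in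 E(\Gamma)}l_{p_iq_i}\big(l^+_{p_ip_i}-l^+_{q_iq_i}\big)^2+\frac1v\operatorname{tr}(\mathrm{L}^+).$$ -/

import Mathlib

open MeasureTheory Set

/-! ### Moore–Penrose pseudo-inverse of a real square matrix -/

namespace Matrix

/-- `B` is the Moore–Penrose generalized inverse of the real square matrix `A`. -/
structure IsMoorePenroseInverse {n : Type*} [Fintype n] (A B : Matrix n n ℝ) : Prop where
  mul_mul_self : A * B * A = A
  mul_mul_inverse : B * A * B = B
  transpose_left : (A * B)ᵀ = A * B
  transpose_right : (B * A)ᵀ = B * A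

theorem IsMoorePenroseInverse.unique {n : Type*} [Fintype n] {A B C : Matrix n n ℝ}
    (hB : A.IsMoorePenroseInverse B) (hC : A.IsMoorePenroseInverse C) : B = C := by
  have h1 : A * C * (A * B) = A * C := by
    have h : (A * B * (A * C))ᵀ = (A * C)ᵀ := by
      rw [← Matrix.mul_assoc, hB.mul_mul_self]
    rwa [transpose_mul, hB.transpose_left, hC.transpose_left] at h
  have h2 : C * A * (B * A) = B * A := by
    have h : (B * A * (C * A))ᵀ = (B * A)ᵀ := by
      rw [Matrix.mul_assoc, ← Matrix.mul_assoc A C A, hC.mul_mul_self]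
    rwa [transpose_mul, hB.transpose_right, hC.transpose_right] at h
  calc B = B * A * B := hB.mul_mul_inverse.symm
    _ = B * (A * C * A) * B := by rw [hC.mul_mul_self]
    _ = B * (A * C * (A * B)) := by simp only [Matrix.mul_assoc]
    _ = B * A * C := by rw [h1, Matrix.mul_assoc]
    _ = C * A * (B * A) * C := by rw [h2]
    _ = C * (A * B * A) * C := by simp only [Matrix.mul_assoc]
    _ = C := by rw [hB.mul_mul_self, hC.mul_mul_inverse]

theorem exists_isMoorePenroseInverse {n : Type*} [Fintype n] (A : Matrix n n ℝ) :
    ∃ B, A.IsMoorePenroseInverse B := by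
  classical
  -- the symmetric case, through diagonalization
  have key : ∀ M : Matrix n n ℝ, M.IsHermitian →
      ∃ P : Matrix n n ℝ, Pᵀ = P ∧ M.IsMoorePenroseInverse P := by
    intro M hM
    let U : Matrix n n ℝ := hM.eigenvectorUnitary
    let d : n → ℝ := hM.eigenvalues
    have hU : Uᵀ * U = 1 := by
      have := Unitary.coe_star_mul_self hM.eigenvectorUnitary
      rwa [star_eq_conjTranspose, conjTranspose_eq_transpose_of_trivial] at this
    have hMd : M = U * diagonal d * Uᵀ := by
      have := hM.spectral_theorem
      rwa [Unitary.conjStarAlgAut_apply, star_eq_conjTranspose,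
        conjTranspose_eq_transpose_of_trivial] at this
    have hmul : ∀ f g : n → ℝ, (U * diagonal f * Uᵀ) * (U * diagonal g * Uᵀ) =
        U * diagonal (fun i => f i * g i) * Uᵀ := by
      intro f g
      calc _ = U * diagonal f * (Uᵀ * U) * diagonal g * Uᵀ := by simp only [Matrix.mul_assoc]
        _ = _ := by rw [hU, Matrix.mul_one, Matrix.mul_assoc U, diagonal_mul_diagonal]
    have htr : ∀ f : n → ℝ, (U * diagonal f * Uᵀ)ᵀ = U * diagonal f * Uᵀ := by
      intro f
      simp [transpose_mul, Matrix.mul_assoc]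
    refine ⟨U * diagonal (fun i => (d i)⁻¹) * Uᵀ, htr _, ?_, ?_, ?_, ?_⟩
    · rw [hMd, hmul, hmul]; congr; funext i; exact mul_inv_mul_cancel _
    · rw [hMd, hmul, hmul]; congr; funext i; simpa using mul_inv_mul_cancel (d i)⁻¹
    · rw [hMd, hmul, htr]
    · rw [hMd, hmul, htr]
  obtain ⟨P, hPt, hP⟩ := key (Aᵀ * A) (by
    have := isHermitian_conjTranspose_mul_self A
    rwa [conjTranspose_eq_transpose_of_trivial] at this)
  have hA : A * P * (Aᵀ * A) = A := by
    rw [← sub_eq_zero, ← conjTranspose_mul_self_eq_zero, conjTranspose_eq_transpose_of_trivial]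
    have h0 : Aᵀ * (A * P * (Aᵀ * A) - A) = 0 := by
      rw [Matrix.mul_sub, sub_eq_zero]
      simpa only [Matrix.mul_assoc] using hP.mul_mul_self
    have h1 : A * P * (Aᵀ * A) - A = A * (P * (Aᵀ * A) - 1) := by
      rw [Matrix.mul_sub, Matrix.mul_one, Matrix.mul_assoc]
    calc _ = (A * (P * (Aᵀ * A) - 1))ᵀ * (A * P * (Aᵀ * A) - A) := by rw [← h1]
      _ = 0 := by rw [transpose_mul, Matrix.mul_assoc, h0, Matrix.mul_zero]
  refine ⟨P * Aᵀ, ?_, ?_, ?_, ?_⟩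
  · simpa only [Matrix.mul_assoc] using hA
  · have := congrArg (· * Aᵀ) hP.mul_mul_inverse
    simpa only [Matrix.mul_assoc] using this
  · simp only [transpose_mul, transpose_transpose, hPt, Matrix.mul_assoc]
  · simpa only [Matrix.mul_assoc] using hP.transpose_right

/-- The Moore–Penrose pseudo-inverse of a real square matrix. -/
noncomputable def pseudoInverse {n : Type*} [Fintype n] (A : Matrix n n ℝ) : Matrix n n ℝ :=
  A.exists_isMoorePenroseInverse.choose

theorem isMoorePenroseInverse_pseudoInverse {n : Type*} [Fintype n] (A : Matrix n n ℝ) :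
    A.IsMoorePenroseInverse A.pseudoInverse :=
  A.exists_isMoorePenroseInverse.choose_spec

end Matrix

/-! ### Metrized graphs -/

/-- A metrized graph together with a vertex set: a connected graph with vertices `V` and edges `E`
(loops and multiple edges allowed), in which the edge `e` is parametrized by the segment
`[0, len e]`, running from `src e` to `tgt e`. Finiteness is imposed by `[Fintype V] [Fintype E]`
where the graph is used. -/
structure MetrizedGraph (V E : Type*) where
  src : E → V
  tgt : E → V
  len : E → ℝ
  len_pos : ∀ e, 0 < len e
  nonempty : Nonempty V
  connected : ∀ p q : V, Relation.EqvGen (fun a b => ∃ e, src e = a ∧ tgt e = b) p q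

namespace MetrizedGraph

variable {V E : Type*}

/-- The vertex set is optimal: there are no self-loops and no multiple edges. -/
structure IsOptimal (Γ : MetrizedGraph V E) : Prop where
  no_loop : ∀ e, Γ.src e ≠ Γ.tgt e
  no_multiple : ∀ e e', s(Γ.src e, Γ.tgt e) = s(Γ.src e', Γ.tgt e') → e = e'

/-- The points of the metrized graph: the vertices, and the interior points of the edges. -/
inductive Point (Γ : MetrizedGraph V E) : Type _
  | vertex (p : V) : Point Γ
  | inner (e : E) (t : ℝ) (ht : t ∈ Ioo 0 (Γ.len e)) : Point Γ

open Classical in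
/-- The arclength parametrization `[0, len e] → Γ` of the edge `e`, extended to `ℝ` by its
end values. -/
noncomputable def path (Γ : MetrizedGraph V E) (e : E) (t : ℝ) : Γ.Point :=
  if h : t ∈ Ioo 0 (Γ.len e) then .inner e t h
  else if t ≤ 0 then .vertex (Γ.src e) else .vertex (Γ.tgt e)

/-- The topology of `Γ`, the quotient topology obtained by gluing the segments `[0, len e]` at the
vertices: a set is open iff its preimage under each edge parametrization is open. -/
noncomputable instance (Γ : MetrizedGraph V E) : TopologicalSpace Γ.Point :=
  ⨆ e, TopologicalSpace.coinduced (Γ.path e) inferInstance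

noncomputable instance (Γ : MetrizedGraph V E) : MeasurableSpace Γ.Point := borel _

instance (Γ : MetrizedGraph V E) : BorelSpace Γ.Point := ⟨rfl⟩

theorem continuous_path (Γ : MetrizedGraph V E) (e : E) : Continuous (Γ.path e) :=
  continuous_iff_coinduced_le.2
    (le_iSup (fun e => TopologicalSpace.coinduced (Γ.path e) inferInstance) e)

/-- The measure `dx` on `Γ`: Lebesgue measure along each edge. -/
noncomputable def lengthMeasure [Fintype E] (Γ : MetrizedGraph V E) : Measure Γ.Point :=
  ∑ e, Measure.map (Γ.path e) (volume.restrict (Ioo 0 (Γ.len e)))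

/-- The function `f''`, second derivative along the edges (vertices form a null set). -/
noncomputable def secondDeriv (Γ : MetrizedGraph V E) (f : Γ.Point → ℝ) : Γ.Point → ℝ
  | .vertex _ => 0
  | .inner e t _ => iteratedDeriv 2 (fun s => f (Γ.path e s)) t

/-- The class `Zh(Γ)` of (real valued) continuous functions that are `C²` off some vertex set, with
`f'' ∈ L¹(Γ)`. A vertex set of `Γ` is a finite set of points that contains the given vertices. -/
def Zh [Fintype E] (Γ : MetrizedGraph V E) (f : Γ.Point → ℝ) : Prop :=
  Continuous f ∧
  (∃ S : Set Γ.Point, S.Finite ∧ (∀ p, Point.vertex p ∈ S) ∧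
    ∀ e t ht, Point.inner e t ht ∉ S → ContDiffAt ℝ 2 (fun s => f (Γ.path e s)) t) ∧
  Integrable (Γ.secondDeriv f) Γ.lengthMeasure

open Classical in
/-- The sum of the one-sided derivatives of `f` at a point, over all directions emanating from the
point (a self-loop at a vertex gives two directions). -/
noncomputable def slopeSum [Fintype E] (Γ : MetrizedGraph V E) (f : Γ.Point → ℝ) : Γ.Point → ℝ
  | .vertex p => ∑ e,
      ((if Γ.src e = p then derivWithin (fun s => f (Γ.path e s)) (Ici 0) 0 else 0) -
       (if Γ.tgt e = p then derivWithin (fun s => f (Γ.path e s)) (Iic (Γ.len e)) (Γ.len e) else 0))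
  | .inner e t _ =>
      derivWithin (fun s => f (Γ.path e s)) (Ici t) t -
      derivWithin (fun s => f (Γ.path e s)) (Iic t) t

/-- The measure valued Laplacian `Δ f = - f'' dx - ∑ₚ [∑ᵥ dᵥ f (p)] δₚ`. At points of valence two
where `f` is differentiable the coefficient of `δₚ` vanishes, so for `f ∈ Zh(Γ)` the sum has
finitely many nonzero terms, and may be taken over any vertex set off which `f` is `C²`. -/
noncomputable def laplacian [Fintype E] (Γ : MetrizedGraph V E) (f : Γ.Point → ℝ) :
    SignedMeasure Γ.Point :=
  - Γ.lengthMeasure.withDensityᵥ (Γ.secondDeriv f) -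
    ∑ᶠ p : Γ.Point, Γ.slopeSum f p • VectorMeasure.dirac p (1 : ℝ)

/-- `f` is the voltage `x ↦ j_z(x, y)` when unit current enters at `y` and exits at `z`, with
reference voltage `0` at `z`: `Δ f = δ_y - δ_z` and `f z = 0`. -/
structure IsVoltage [Fintype E] (Γ : MetrizedGraph V E) (z y : Γ.Point) (f : Γ.Point → ℝ) :
    Prop where
  zh : Γ.Zh f
  laplacian_eq : Γ.laplacian f = VectorMeasure.dirac y (1 : ℝ) - VectorMeasure.dirac z (1 : ℝ)
  reference : f z = 0

open Classical in
/-- The voltage function `j_z(x, y)`. -/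
noncomputable def voltage [Fintype E] (Γ : MetrizedGraph V E) (z x y : Γ.Point) : ℝ :=
  if h : ∃ f, Γ.IsVoltage z y f then h.choose x else 0

/-- `j_μ(x, y) = ∫ j_ζ(x, y) dμ(ζ)` for a finite signed Borel measure `μ`. -/
noncomputable def voltageAvg [Fintype E] (Γ : MetrizedGraph V E) (μ : SignedMeasure Γ.Point)
    (x y : Γ.Point) : ℝ :=
  ∫ᵛ ζ, Γ.voltage ζ x y ∂•μ

/-- `μ` is a canonical measure: a finite signed Borel measure of total mass `1` such that
`j_μ(x, x)` is constant. -/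
def IsCanonicalMeasure [Fintype E] (Γ : MetrizedGraph V E) (μ : SignedMeasure Γ.Point) : Prop :=
  μ univ = 1 ∧ ∃ c : ℝ, ∀ x, Γ.voltageAvg μ x x = c

open Classical in
/-- The canonical measure `μ_can`. -/
noncomputable def canonicalMeasure [Fintype E] (Γ : MetrizedGraph V E) : SignedMeasure Γ.Point :=
  if h : ∃ μ, Γ.IsCanonicalMeasure μ then h.choose else 0

/-- The tau constant: the constant value of `½ j_μ(x, x)` for `μ = μ_can`. -/
noncomputable def tauConstant [Fintype E] (Γ : MetrizedGraph V E) : ℝ :=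
  (1 / 2) * Γ.voltageAvg Γ.canonicalMeasure
    (.vertex (Classical.choice Γ.nonempty)) (.vertex (Classical.choice Γ.nonempty))

open Classical in
/-- The adjacency matrix: `a_pq = 1 / L_k` if `p ≠ q` are joined by an edge of length `L_k`, and
`0` otherwise. For an optimal vertex set the sum has at most one term. -/
noncomputable def adjacencyMatrix [Fintype E] (Γ : MetrizedGraph V E) : Matrix V V ℝ :=
  Matrix.of fun p q =>
    if p = q then 0
    else ∑ e, if (Γ.src e = p ∧ Γ.tgt e = q) ∨ (Γ.src e = q ∧ Γ.tgt e = p)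
      then 1 / Γ.len e else 0

open Classical in
/-- The discrete Laplacian matrix `L = D - A`. -/
noncomputable def discreteLaplacian [Fintype V] [Fintype E] (Γ : MetrizedGraph V E) :
    Matrix V V ℝ :=
  Matrix.diagonal (fun p => ∑ s, Γ.adjacencyMatrix p s) - Γ.adjacencyMatrix

end MetrizedGraph

open Filter Topology
open scoped Matrix

/-! Write `P` for the pseudo-inverse, `v` for the number of vertices and `ν` for the uniform
probability measure on the vertices. Interpolating `P` bilinearly along the edges and adding on each
edge its Green function with zero boundary values gives a symmetric kernel `g(x,y)` with `Δ_x g(x,y)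
= δ_y - ν` (`slopeSum_green`); the input is that `L * P` is the identity minus the matrix with all
entries `1/v`. Voltages are unique by an energy argument (`IsVoltage.unique`), so `j_z(x,y) = g(x,y)
- g(x,z) + g(z,z) - g(z,y)`. In particular `j_ζ(x,x) = g(x,x) + g(ζ,ζ) - 2 g(x,ζ)`, the effective
resistance `r(x,ζ)`.

A canonical measure is `μ = ν + ½ Δ(g(x,x))`. Integration by parts, together with `∫ g(x,·) dν = 0`,
gives `∫ g(x,ζ) dμ(ζ) = ½ g(x,x) - tr P / (2v)` (`integral_green`), so the dependence on `x` cancels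
in `∫ r(x,ζ) dμ(ζ)`. Computed out, `μ` has mass `1 - val(p)/2` at the vertex `p` and density `κ =
1/len - R/len²` along an edge whose end points have resistance `R`.

What remains is `∫ g(ζ,ζ) dμ + tr P / v`. The diagonal of `g` is an affine interpolation of `P p p`
plus `κ s (len - s)` on each edge. The first piece contributes `tr P / v` and half the Dirichlet
form of the diagonal of `P`, the second `∑ κ² len³ / 6`. Halving gives both formulas.

The measure picked by choice in the definition of `τ` need not be compared with `μ`: since `r` is
symmetric, Fubini shows that all canonical measures have the same constant
(`const_eq_of_voltageAvg_eq`). -/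

/-! ### Piecewise affine functions on an interval. -/

theorem exists_affine_of_iteratedDeriv_two_eq_zero {u : ℝ → ℝ} {a b : ℝ} (hab : a < b)
    (hu : ∀ t ∈ Ioo a b, ContDiffAt ℝ 2 u t) (h0 : ∀ t ∈ Ioo a b, iteratedDeriv 2 u t = 0) :
    ∃ A B : ℝ, ∀ t ∈ Ioo a b, u t = A + B * t := by
  obtain ⟨m, hm⟩ : (Ioo a b).Nonempty := nonempty_Ioo.2 hab
  have hd : ∀ t ∈ Ioo a b, DifferentiableAt ℝ u t := fun t ht =>
    (hu t ht).differentiableAt (by norm_num)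
  have hd2 : DifferentiableOn ℝ (deriv u) (Ioo a b) := fun t ht => by
    have h := ((hu t ht).fderiv_right (m := 1) (by norm_num)).differentiableAt one_ne_zero
    exact (h.clm_apply (differentiableAt_const (1 : ℝ))).differentiableWithinAt
  have h1 : ∀ t ∈ Ioo a b, deriv u t = deriv u m := fun t ht =>
    isOpen_Ioo.is_const_of_deriv_eq_zero isPreconnected_Ioo hd2
      (fun s hs => by simpa [iteratedDeriv_succ, iteratedDeriv_zero] using h0 s hs) ht hm
  have h2 : ∀ t ∈ Ioo a b, u t - deriv u m * t = u m - deriv u m * m := fun t ht => by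
    refine isOpen_Ioo.is_const_of_deriv_eq_zero (f := fun t => u t - deriv u m * t)
      isPreconnected_Ioo
      (fun s hs => ((hd s hs).sub (by fun_prop)).differentiableWithinAt) (fun s hs => ?_) ht hm
    have : HasDerivAt (fun t => u t - deriv u m * t) (deriv u s - deriv u m * 1) s :=
      (hd s hs).hasDerivAt.sub ((hasDerivAt_id s).const_mul _)
    rw [this.deriv, h1 s hs]; simp
  exact ⟨u m - deriv u m * m, deriv u m, fun t ht => by rw [← h2 t ht]; ring⟩

/-- A set of full measure is dense and the second derivative is continuous at `t`. The equation for
`Δ f` only yields `f'' = 0` almost everywhere; this makes it pointwise. -/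
theorem iteratedDeriv_two_eq_zero_of_ae {u : ℝ → ℝ} {a b t : ℝ} (ht : t ∈ Ioo a b)
    (hu : ContDiffAt ℝ 2 u t) (h0 : ∀ᵐ s ∂volume.restrict (Ioo a b), iteratedDeriv 2 u s = 0) :
    iteratedDeriv 2 u t = 0 := by
  by_contra hne
  have hc : ContinuousAt (iteratedDeriv 2 u) t := by
    have h := hu.continuousAt_iteratedFDeriv (k := 2) le_rfl
    exact (ContinuousMultilinearMap.apply ℝ (fun _ : Fin 2 => ℝ) ℝ
      (fun _ => 1)).continuous.continuousAt.comp h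
  rw [ae_restrict_iff' measurableSet_Ioo] at h0
  have hd := Measure.dense_of_ae h0
  obtain ⟨s, hs, hs1, hs2⟩ := (mem_closure_iff_frequently.1 (hd t)).and_eventually
    ((hc.eventually_ne hne).and (isOpen_Ioo.mem_nhds ht)) |>.exists
  exact hs1 (hs hs2)

theorem contDiffAt_of_eventually_affine {u : ℝ → ℝ} {t A c : ℝ}
    (h : ∀ᶠ s in 𝓝 t, u s = A + c * (s - t)) : ContDiffAt ℝ 2 u t :=
  (by fun_prop : ContDiffAt ℝ 2 (fun s => A + c * (s - t)) t).congr_of_eventuallyEq h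

theorem iteratedDeriv_two_of_eventually_affine {u : ℝ → ℝ} {t A c : ℝ}
    (h : ∀ᶠ s in 𝓝 t, u s = A + c * (s - t)) : iteratedDeriv 2 u t = 0 := by
  have h1 : u =ᶠ[𝓝 t] fun s => A + c * (s - t) := h
  rw [(h1.iteratedDeriv 2).eq_of_nhds, iteratedDeriv_succ, iteratedDeriv_one]
  have : deriv (fun s => A + c * (s - t)) = fun _ => c := by
    funext s
    simp
  rw [this]; simp

/-- Near `t`, on the right, `u` agrees with its one-sided tangent. -/
def RightAffineAt (u : ℝ → ℝ) (t : ℝ) : Prop :=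
  ∀ᶠ s in 𝓝[≥] t, u s = u t + derivWithin u (Ici t) t * (s - t)

/-- Near `t`, on the left, `u` agrees with its one-sided tangent. -/
def LeftAffineAt (u : ℝ → ℝ) (t : ℝ) : Prop :=
  ∀ᶠ s in 𝓝[≤] t, u s = u t + derivWithin u (Iic t) t * (s - t)

theorem derivWithin_Ici_of_eventually {u : ℝ → ℝ} {t c : ℝ}
    (h : ∀ᶠ s in 𝓝[≥] t, u s = u t + c * (s - t)) : derivWithin u (Ici t) t = c := by
  have h1 : HasDerivWithinAt (fun s => u t + c * (s - t)) c (Ici t) t := by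
    simpa using (((hasDerivAt_id t).sub_const t).const_mul c).const_add (u t) |>.hasDerivWithinAt
  exact (h1.congr_of_eventuallyEq h (by simp)).derivWithin (uniqueDiffWithinAt_Ici t)

theorem derivWithin_Iic_of_eventually {u : ℝ → ℝ} {t c : ℝ}
    (h : ∀ᶠ s in 𝓝[≤] t, u s = u t + c * (s - t)) : derivWithin u (Iic t) t = c := by
  have h1 : HasDerivWithinAt (fun s => u t + c * (s - t)) c (Iic t) t := by
    simpa using (((hasDerivAt_id t).sub_const t).const_mul c).const_add (u t) |>.hasDerivWithinAt
  exact (h1.congr_of_eventuallyEq h (by simp)).derivWithin (uniqueDiffWithinAt_Iic t)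

theorem rightAffineAt_of_affine_Ioo {u : ℝ → ℝ} (hc : Continuous u) {t b A B : ℝ} (hb : t < b)
    (h : ∀ s ∈ Ioo t b, u s = A + B * s) : RightAffineAt u t := by
  have h0 : u t = A + B * t := by
    have h1 : Tendsto u (𝓝[>] t) (𝓝 (u t)) := hc.continuousWithinAt
    have h2 : Tendsto (fun s => A + B * s) (𝓝[>] t) (𝓝 (A + B * t)) :=
      (by fun_prop : Continuous fun s : ℝ => A + B * s).continuousWithinAt
    refine tendsto_nhds_unique (h1.congr' ?_) h2
    filter_upwards [Ioo_mem_nhdsGT hb] with s hs using h s hs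
  have h1 : ∀ᶠ s in 𝓝[≥] t, u s = u t + B * (s - t) := by
    filter_upwards [Ico_mem_nhdsGE hb] with s hs
    rcases hs.1.eq_or_lt with rfl | hlt
    · simp
    · rw [h s ⟨hlt, hs.2⟩, h0]; ring
  rw [RightAffineAt, derivWithin_Ici_of_eventually h1]
  exact h1

theorem leftAffineAt_of_affine_Ioo {u : ℝ → ℝ} (hc : Continuous u) {t a A B : ℝ} (ha : a < t)
    (h : ∀ s ∈ Ioo a t, u s = A + B * s) : LeftAffineAt u t := by
  have h0 : u t = A + B * t := by
    have h1 : Tendsto u (𝓝[<] t) (𝓝 (u t)) := hc.continuousWithinAt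
    have h2 : Tendsto (fun s => A + B * s) (𝓝[<] t) (𝓝 (A + B * t)) :=
      (by fun_prop : Continuous fun s : ℝ => A + B * s).continuousWithinAt
    refine tendsto_nhds_unique (h1.congr' ?_) h2
    filter_upwards [Ioo_mem_nhdsLT ha] with s hs using h s hs
  have h1 : ∀ᶠ s in 𝓝[≤] t, u s = u t + B * (s - t) := by
    filter_upwards [Ioc_mem_nhdsLE ha] with s hs
    rcases hs.2.eq_or_lt with rfl | hlt
    · simp
    · rw [h s ⟨hs.1, hlt⟩, h0]; ring
  rw [LeftAffineAt, derivWithin_Iic_of_eventually h1]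
  exact h1

/-- A finite set misses some interval immediately to the right of `t`, whether or not `t` belongs to
it, and there `u` is affine. -/
theorem rightAffineAt_of_finite {u : ℝ → ℝ} (hc : Continuous u) {L : ℝ} {S : Set ℝ}
    (hS : S.Finite) (hu : ∀ t ∈ Ioo 0 L, t ∉ S → ContDiffAt ℝ 2 u t)
    (h0 : ∀ t ∈ Ioo 0 L, t ∉ S → iteratedDeriv 2 u t = 0) {t : ℝ} (ht : t ∈ Ico 0 L) :
    RightAffineAt u t := by
  have h1 : ∀ᶠ s in 𝓝[>] t, s ∉ S := by
    have h2 : (S \ {t})ᶜ ∈ 𝓝 t := (hS.subset sdiff_subset).isClosed.isOpen_compl.mem_nhds (by simp)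
    filter_upwards [mem_nhdsWithin_of_mem_nhds h2, self_mem_nhdsWithin] with s hs hst hsS
    exact hs ⟨hsS, (ne_of_gt hst)⟩
  obtain ⟨b, hb, hbS⟩ := (mem_nhdsGT_iff_exists_Ioo_subset).1
    (h1.and (Ioo_mem_nhdsGT ht.2))
  have hsub : ∀ s ∈ Ioo t b, s ∈ Ioo 0 L ∧ s ∉ S := fun s hs =>
    ⟨⟨ht.1.trans_lt hs.1, (hbS hs).2.2⟩, (hbS hs).1⟩
  obtain ⟨A, B, h⟩ := exists_affine_of_iteratedDeriv_two_eq_zero (u := u) hb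
    (fun s hs => hu s (hsub s hs).1 (hsub s hs).2) (fun s hs => h0 s (hsub s hs).1 (hsub s hs).2)
  exact rightAffineAt_of_affine_Ioo hc hb h

theorem leftAffineAt_of_finite {u : ℝ → ℝ} (hc : Continuous u) {L : ℝ} {S : Set ℝ}
    (hS : S.Finite) (hu : ∀ t ∈ Ioo 0 L, t ∉ S → ContDiffAt ℝ 2 u t)
    (h0 : ∀ t ∈ Ioo 0 L, t ∉ S → iteratedDeriv 2 u t = 0) {t : ℝ} (ht : t ∈ Ioc 0 L) :
    LeftAffineAt u t := by
  have h1 : ∀ᶠ s in 𝓝[<] t, s ∉ S := by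
    have h2 : (S \ {t})ᶜ ∈ 𝓝 t := (hS.subset sdiff_subset).isClosed.isOpen_compl.mem_nhds (by simp)
    filter_upwards [mem_nhdsWithin_of_mem_nhds h2, self_mem_nhdsWithin] with s hs hst hsS
    exact hs ⟨hsS, (ne_of_lt hst)⟩
  obtain ⟨a, ha, haS⟩ := (mem_nhdsLT_iff_exists_Ioo_subset).1
    (h1.and (Ioo_mem_nhdsLT ht.1))
  have hsub : ∀ s ∈ Ioo a t, s ∈ Ioo 0 L ∧ s ∉ S := fun s hs =>
    ⟨⟨(haS hs).2.1, hs.2.trans_le ht.2⟩, (haS hs).1⟩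
  obtain ⟨A, B, h⟩ := exists_affine_of_iteratedDeriv_two_eq_zero (u := u) ha
    (fun s hs => hu s (hsub s hs).1 (hsub s hs).2) (fun s hs => h0 s (hsub s hs).1 (hsub s hs).2)
  exact leftAffineAt_of_affine_Ioo hc ha h

/-- Two continuous piecewise affine functions on `[0, L]` whose slopes have the same jumps differ by
an affine function. -/
theorem exists_slope_sub {u w : ℝ → ℝ} (hu : Continuous u) (hw : Continuous w) {L : ℝ} (hL : 0 < L)
    (hur : ∀ t ∈ Ico 0 L, RightAffineAt u t) (hul : ∀ t ∈ Ioc 0 L, LeftAffineAt u t)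
    (hwr : ∀ t ∈ Ico 0 L, RightAffineAt w t) (hwl : ∀ t ∈ Ioc 0 L, LeftAffineAt w t)
    (hj : ∀ t ∈ Ioo 0 L, derivWithin u (Ici t) t - derivWithin u (Iic t) t =
      derivWithin w (Ici t) t - derivWithin w (Iic t) t) :
    ∃ c : ℝ, (∀ s ∈ Icc 0 L, u s - w s = u 0 - w 0 + c * s) ∧
      derivWithin u (Ici 0) 0 - derivWithin w (Ici 0) 0 = c ∧
      derivWithin u (Iic L) L - derivWithin w (Iic L) L = c := by
  set h : ℝ → ℝ := fun s => u s - w s with hh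
  have hc : Continuous h := hu.sub hw
  have hr : ∀ t ∈ Ico 0 L, ∀ᶠ s in 𝓝[≥] t,
      h s = h t + (derivWithin u (Ici t) t - derivWithin w (Ici t) t) * (s - t) := fun t ht => by
    filter_upwards [hur t ht, hwr t ht] with s h1 h2
    simp only [hh, h1, h2]; ring
  have hl : ∀ t ∈ Ioc 0 L, ∀ᶠ s in 𝓝[≤] t,
      h s = h t + (derivWithin u (Iic t) t - derivWithin w (Iic t) t) * (s - t) := fun t ht => by
    filter_upwards [hul t ht, hwl t ht] with s h1 h2
    simp only [hh, h1, h2]; ring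
  -- Equal jumps mean that the left and right slopes of `h` agree, so `h` is affine across every
  -- break point and in particular `C²` there.
  have ha : ∀ t ∈ Ioo 0 L, ∃ c, h =ᶠ[𝓝 t] fun s => h t + c * (s - t) := fun t ht => by
    refine ⟨derivWithin u (Ici t) t - derivWithin w (Ici t) t, ?_⟩
    rw [EventuallyEq, ← nhdsLE_sup_nhdsGE t, eventually_sup]
    refine ⟨?_, hr t ⟨ht.1.le, ht.2⟩⟩
    have h1 := hl t ⟨ht.1, ht.2.le⟩
    have h2 := hj t ht
    rwa [show derivWithin u (Iic t) t - derivWithin w (Iic t) t =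
      derivWithin u (Ici t) t - derivWithin w (Ici t) t by linarith] at h1
  obtain ⟨A, B, hAB⟩ := exists_affine_of_iteratedDeriv_two_eq_zero (u := h) hL
    (fun t ht => by
      obtain ⟨c, hc⟩ := ha t ht
      exact contDiffAt_of_eventually_affine hc)
    (fun t ht => by
      obtain ⟨c, hc⟩ := ha t ht
      exact iteratedDeriv_two_of_eventually_affine hc)
  have hI : ∀ s ∈ Icc 0 L, h s = A + B * s := by
    rw [← closure_Ioo hL.ne]
    intro s hs
    have : IsClosed {s | h s = A + B * s} := isClosed_eq hc (by fun_prop)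
    exact closure_minimal (fun s hs => hAB s hs) this hs
  refine ⟨B, fun s hs => ?_, ?_, ?_⟩
  · change h s = h 0 + B * s
    rw [hI s hs, hI 0 ⟨le_rfl, hL.le⟩]; ring
  · rw [← derivWithin_Ici_of_eventually (hr 0 ⟨le_rfl, hL⟩)]
    refine derivWithin_Ici_of_eventually ?_
    filter_upwards [Ico_mem_nhdsGE hL] with s hs
    rw [hI s ⟨hs.1, hs.2.le⟩, hI 0 ⟨le_rfl, hL.le⟩]; ring
  · rw [← derivWithin_Iic_of_eventually (hl L ⟨hL, le_rfl⟩)]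
    refine derivWithin_Iic_of_eventually ?_
    filter_upwards [Ioc_mem_nhdsLE hL] with s hs
    rw [hI s ⟨hs.1.le, hs.2⟩, hI L ⟨hL.le, le_rfl⟩]; ring

/-! ### Points, coordinates and elementary functions on a metrized graph. -/

namespace MetrizedGraph

variable {V E : Type*} {Γ : MetrizedGraph V E}

theorem path_of_mem {e : E} {t : ℝ} (ht : t ∈ Ioo 0 (Γ.len e)) : Γ.path e t = .inner e t ht :=
  dif_pos ht

theorem path_of_nonpos {e : E} {t : ℝ} (ht : t ≤ 0) : Γ.path e t = .vertex (Γ.src e) := by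
  rw [path, dif_neg (fun h => absurd h.1 ht.not_gt), if_pos ht]

theorem path_of_len_le {e : E} {t : ℝ} (ht : Γ.len e ≤ t) : Γ.path e t = .vertex (Γ.tgt e) := by
  rw [path, dif_neg (fun h => absurd h.2 ht.not_gt),
    if_neg (((Γ.len_pos e).trans_le ht).not_ge)]

theorem continuous_iff_path {X : Type*} [TopologicalSpace X] {f : Γ.Point → X} :
    Continuous f ↔ ∀ e, Continuous fun s => f (Γ.path e s) := by
  rw [continuous_iSup_dom]
  exact forall_congr' fun e => continuous_coinduced_dom

theorem path_eq_vertex_iff {e : E} {t : ℝ} {p : V} : Γ.path e t = .vertex p ↔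
    (t ≤ 0 ∧ Γ.src e = p) ∨ (Γ.len e ≤ t ∧ Γ.tgt e = p) := by
  by_cases h0 : t ≤ 0
  · have := (h0.trans_lt (Γ.len_pos e)).not_ge
    simp [path_of_nonpos h0, h0, this]
  by_cases h1 : Γ.len e ≤ t
  · simp [path_of_len_le h1, h0, h1]
  · simp [path_of_mem ⟨not_le.1 h0, not_le.1 h1⟩, h0, h1]

theorem path_eq_inner_iff {e e' : E} {t s : ℝ} {hs : s ∈ Ioo 0 (Γ.len e')} :
    Γ.path e t = .inner e' s hs ↔ e = e' ∧ t = s := by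
  constructor
  · intro h
    by_cases h0 : t ≤ 0
    · simp [path_of_nonpos h0] at h
    by_cases h1 : Γ.len e ≤ t
    · simp [path_of_len_le h1] at h
    · rw [path_of_mem ⟨not_le.1 h0, not_le.1 h1⟩] at h
      injection h with he ht
      exact ⟨he, ht⟩
  · rintro ⟨rfl, rfl⟩
    exact path_of_mem hs

/-- The preimage in each edge is a union of closed rays or at most one point. It makes points Borel
sets, so that atoms of measures can be read off. -/
theorem isClosed_singleton_point (x : Γ.Point) : IsClosed ({x} : Set Γ.Point) := by
  rw [isClosed_iSup_iff]
  intro e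
  rw [isClosed_coinduced]
  cases x with
  | vertex p =>
    have : Γ.path e ⁻¹' {.vertex p} =
        {t | t ≤ 0 ∧ Γ.src e = p} ∪ {t | Γ.len e ≤ t ∧ Γ.tgt e = p} := by
      ext t; simp [path_eq_vertex_iff]
    rw [this]
    by_cases h1 : Γ.src e = p <;> by_cases h2 : Γ.tgt e = p <;>
      simp only [h1, h2, and_true, and_false, ofPred_false, union_empty, empty_union,
        isClosed_empty]
    exacts [isClosed_Iic.union isClosed_Ici, isClosed_Iic, isClosed_Ici]
  | inner e' s hs =>
    have : Γ.path e ⁻¹' {.inner e' s hs} = {t | e = e' ∧ t = s} := by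
      ext t; simp [path_eq_inner_iff]
    rw [this]
    by_cases h : e = e' <;> simp [h]

instance (Γ : MetrizedGraph V E) : MeasurableSingletonClass Γ.Point :=
  ⟨fun x => (isClosed_singleton_point x).measurableSet⟩

theorem measurable_path (Γ : MetrizedGraph V E) (e : E) : Measurable (Γ.path e) :=
  (Γ.continuous_path e).measurable

/-- The projection of the line onto `[0, len e]`. -/
noncomputable def clamp (Γ : MetrizedGraph V E) (e : E) (s : ℝ) : ℝ := max 0 (min s (Γ.len e))

theorem continuous_clamp (e : E) : Continuous (Γ.clamp e) := by
  unfold clamp; fun_prop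

theorem clamp_of_mem {e : E} {s : ℝ} (hs : s ∈ Icc 0 (Γ.len e)) : Γ.clamp e s = s := by
  rw [clamp, min_eq_left hs.2, max_eq_right hs.1]

theorem clamp_of_nonpos {e : E} {s : ℝ} (hs : s ≤ 0) : Γ.clamp e s = 0 := by
  rw [clamp, max_eq_left ((min_le_left _ _).trans hs)]

theorem clamp_of_len_le {e : E} {s : ℝ} (hs : Γ.len e ≤ s) : Γ.clamp e s = Γ.len e := by
  rw [clamp, min_eq_right hs, max_eq_right (Γ.len_pos e).le]

/-- The function on `Γ` that is affine along the edges and has given values at the vertices. -/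
noncomputable def interp (Γ : MetrizedGraph V E) (f : V → ℝ) : Γ.Point → ℝ
  | .vertex p => f p
  | .inner e t _ => (1 - t / Γ.len e) * f (Γ.src e) + t / Γ.len e * f (Γ.tgt e)

/-- Since `path` is constant beyond its ends, clamping gives one formula on all of `ℝ`, from which
continuity is immediate. -/
theorem interp_path (f : V → ℝ) (e : E) (s : ℝ) : Γ.interp f (Γ.path e s) =
    (1 - Γ.clamp e s / Γ.len e) * f (Γ.src e) + Γ.clamp e s / Γ.len e * f (Γ.tgt e) := by
  by_cases h0 : s ≤ 0
  · simp [path_of_nonpos h0, clamp_of_nonpos h0, interp]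
  by_cases h1 : Γ.len e ≤ s
  · simp [path_of_len_le h1, clamp_of_len_le h1, interp, div_self (Γ.len_pos e).ne']
  have h : s ∈ Ioo 0 (Γ.len e) := ⟨not_le.1 h0, not_le.1 h1⟩
  rw [path_of_mem h, clamp_of_mem (Ioo_subset_Icc_self h), interp]

theorem continuous_interp (f : V → ℝ) : Continuous (Γ.interp f) := by
  rw [continuous_iff_path]
  intro e
  simp only [interp_path]
  have := Γ.continuous_clamp e
  fun_prop

theorem interp_sub (f g : V → ℝ) (x : Γ.Point) :
    Γ.interp (fun p => f p - g p) x = Γ.interp f x - Γ.interp g x := by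
  cases x <;> simp only [interp] <;> ring

theorem interp_const_mul (c : ℝ) (f : V → ℝ) (x : Γ.Point) :
    Γ.interp (fun p => c * f p) x = c * Γ.interp f x := by
  cases x <;> simp only [interp] <;> ring

theorem interp_const (c : ℝ) (x : Γ.Point) : Γ.interp (fun _ => c) x = c := by
  cases x <;> simp only [interp]; ring

theorem interp_sum {ι : Type*} (s : Finset ι) (f : ι → V → ℝ) (x : Γ.Point) :
    Γ.interp (fun p => ∑ i ∈ s, f i p) x = ∑ i ∈ s, Γ.interp (f i) x := by
  cases x <;> simp only [interp, Finset.mul_sum, Finset.sum_add_distrib]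

theorem interp_comm (M : V → V → ℝ) (x y : Γ.Point) :
    Γ.interp (fun p => Γ.interp (fun q => M p q) y) x =
      Γ.interp (fun q => Γ.interp (fun p => M p q) x) y := by
  cases x <;> cases y <;> simp only [interp] <;> ring

open Classical in
/-- The coordinate along the edge `e`, extended by zero. -/
noncomputable def coord (Γ : MetrizedGraph V E) (e : E) : Γ.Point → ℝ
  | .vertex _ => 0
  | .inner e' t _ => if e' = e then t else 0

theorem coord_mem (e : E) (x : Γ.Point) : Γ.coord e x ∈ Ico 0 (Γ.len e) := by
  cases x with
  | vertex p => exact ⟨le_rfl, Γ.len_pos e⟩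
  | inner e' t ht =>
    by_cases h : e' = e
    · subst h; simpa [coord] using ⟨ht.1.le, ht.2⟩
    · simpa [coord, h] using Γ.len_pos e

theorem coord_path (e : E) {s : ℝ} (hs : s ∈ Ioo 0 (Γ.len e)) : Γ.coord e (Γ.path e s) = s := by
  simp [path_of_mem hs, coord]

theorem coord_path_of_ne {e e' : E} (h : e' ≠ e) (s : ℝ) : Γ.coord e (Γ.path e' s) = 0 := by
  unfold path; split_ifs <;> simp [coord, h]

/-- The coordinate is discontinuous at the far end of the edge, where it tends to `len e` but takes
the value `0`. The cut-offs `F n` are continuous, and they converge pointwise because the coordinate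
stays strictly below `len e`. -/
theorem measurable_coord (e : E) : Measurable (Γ.coord e) := by
  let F : ℕ → Γ.Point → ℝ := fun n x => min (Γ.coord e x) (n * (Γ.len e - Γ.coord e x))
  have hz : ∀ n : ℕ, ∀ x, Γ.coord e x = 0 → F n x = 0 := fun n x hx => by
    have : 0 ≤ (n : ℝ) * Γ.len e := by have := (Γ.len_pos e).le; positivity
    simp [F, hx, this]
  have hF : ∀ n, Continuous (F n) := fun n => by
    rw [continuous_iff_path]
    intro e'
    by_cases he : e' = e
    · subst he
      have h1 : (fun s => F n (Γ.path e' s)) =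
          fun s => min (Γ.clamp e' s) (n * (Γ.len e' - Γ.clamp e' s)) := by
        funext s
        have hn : 0 ≤ (n : ℝ) * Γ.len e' := by have := (Γ.len_pos e').le; positivity
        by_cases h0 : s ≤ 0
        · rw [hz _ _ (by simp [path_of_nonpos h0, coord]), clamp_of_nonpos h0]
          simp [hn]
        by_cases h1 : Γ.len e' ≤ s
        · rw [hz _ _ (by simp [path_of_len_le h1, coord]), clamp_of_len_le h1]
          simp [(Γ.len_pos e').le]
        have h : s ∈ Ioo 0 (Γ.len e') := ⟨not_le.1 h0, not_le.1 h1⟩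
        simp only [F, coord_path e' h, clamp_of_mem (Ioo_subset_Icc_self h)]
      rw [h1]
      have := Γ.continuous_clamp e'
      fun_prop
    · have h1 : (fun s => F n (Γ.path e' s)) = fun _ => 0 := by
        funext s; exact hz _ _ (coord_path_of_ne he s)
      rw [h1]; exact continuous_const
  refine measurable_of_tendsto_metrizable (fun n => (hF n).measurable) ?_
  rw [tendsto_pi_nhds]
  intro x
  have hx := coord_mem e x
  have hpos : 0 < Γ.len e - Γ.coord e x := sub_pos.2 hx.2
  have h1 : Tendsto (fun n : ℕ => (n : ℝ) * (Γ.len e - Γ.coord e x)) atTop atTop :=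
    tendsto_natCast_atTop_atTop.atTop_mul_const hpos
  refine tendsto_const_nhds.congr' ?_
  filter_upwards [h1.eventually_ge_atTop (Γ.coord e x)] with n hn
  exact (min_eq_left hn).symm

section Bump

variable [Fintype E]

/-- The sum of the Green functions, with zero boundary values, of the edges. -/
noncomputable def bump (Γ : MetrizedGraph V E) (x y : Γ.Point) : ℝ :=
  ∑ e, (min (Γ.coord e x) (Γ.coord e y) - Γ.coord e x * Γ.coord e y / Γ.len e)

theorem bump_comm (x y : Γ.Point) : Γ.bump x y = Γ.bump y x := by
  simp only [bump, min_comm, mul_comm]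

/-- The Green function of an edge vanishes at both ends, so the jump of `coord` at the far end does
no harm. -/
theorem bump_path (e : E) (s : ℝ) (y : Γ.Point) : Γ.bump (Γ.path e s) y =
    min (Γ.clamp e s) (Γ.coord e y) - Γ.clamp e s * Γ.coord e y / Γ.len e := by
  have hz : ∀ e', Γ.coord e' (Γ.path e s) = 0 →
      min (Γ.coord e' (Γ.path e s)) (Γ.coord e' y) -
        Γ.coord e' (Γ.path e s) * Γ.coord e' y / Γ.len e' = 0 := fun e' h => by
    simp [h, (coord_mem e' y).1]
  rw [bump, Finset.sum_eq_single e (fun e' _ h => hz e' (coord_path_of_ne h.symm s)) (by simp)]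
  have hy := coord_mem e y
  by_cases h0 : s ≤ 0
  · rw [hz e (by simp [path_of_nonpos h0, coord]), clamp_of_nonpos h0]
    simp [hy.1]
  by_cases h1 : Γ.len e ≤ s
  · rw [hz e (by simp [path_of_len_le h1, coord]), clamp_of_len_le h1, min_eq_right hy.2.le,
      mul_div_cancel_left₀ _ (Γ.len_pos e).ne', sub_self]
  have h : s ∈ Ioo 0 (Γ.len e) := ⟨not_le.1 h0, not_le.1 h1⟩
  rw [coord_path e h, clamp_of_mem (Ioo_subset_Icc_self h)]

theorem bump_vertex (p : V) (y : Γ.Point) : Γ.bump (.vertex p) y = 0 := by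
  have h : ∀ e, Γ.coord e (.vertex p) = 0 := fun _ => rfl
  simp [bump, h, (coord_mem _ y).1]

theorem continuous_bump (y : Γ.Point) : Continuous fun x => Γ.bump x y := by
  rw [continuous_iff_path]
  intro e
  simp only [bump_path]
  have := Γ.continuous_clamp e
  fun_prop

theorem measurable_bump : Measurable fun z : Γ.Point × Γ.Point => Γ.bump z.1 z.2 := by
  have := fun e => Γ.measurable_coord e
  unfold bump
  fun_prop

theorem abs_bump_le (x y : Γ.Point) : |Γ.bump x y| ≤ ∑ e, 2 * Γ.len e := by
  refine (Finset.abs_sum_le_sum_abs _ _).trans (Finset.sum_le_sum fun e _ => ?_)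
  have hx := coord_mem e x
  have hy := coord_mem e y
  have hL := Γ.len_pos e
  have h1 : 0 ≤ Γ.coord e x * Γ.coord e y / Γ.len e :=
    div_nonneg (mul_nonneg hx.1 hy.1) hL.le
  have h2 : Γ.coord e x * Γ.coord e y / Γ.len e ≤ Γ.len e := by
    rw [div_le_iff₀ hL]; exact mul_le_mul hx.2.le hy.2.le hy.1 hL.le
  have h3 := le_min hx.1 hy.1
  have h4 := min_le_left (Γ.coord e x) (Γ.coord e y)
  rw [abs_le]; constructor <;> linarith [hx.2]

end Bump

theorem abs_interp_le {f : V → ℝ} {C : ℝ} (h : ∀ p, |f p| ≤ C) (x : Γ.Point) :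
    |Γ.interp f x| ≤ C := by
  cases x with
  | vertex p => exact h p
  | inner e t ht =>
    have h1 : 0 ≤ t / Γ.len e := div_nonneg ht.1.le (Γ.len_pos e).le
    have h2 : t / Γ.len e ≤ 1 := (div_le_one (Γ.len_pos e)).2 ht.2.le
    have ha := abs_le.1 (h (Γ.src e))
    have hb := abs_le.1 (h (Γ.tgt e))
    rw [interp, abs_le]
    constructor <;> nlinarith

end MetrizedGraph

/-! ### The discrete Laplacian and its pseudo-inverse. -/

namespace MetrizedGraph

variable {V E : Type*} {Γ : MetrizedGraph V E}

theorem eq_of_forall_src_eq_tgt {X : Type*} {f : V → X} (h : ∀ e, f (Γ.src e) = f (Γ.tgt e))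
    (p q : V) : f p = f q := by
  induction Γ.connected p q with
  | rel a b hab => obtain ⟨e, rfl, rfl⟩ := hab; exact h e
  | refl => rfl
  | symm _ _ _ ih => exact ih.symm
  | trans _ _ _ _ _ ih1 ih2 => exact ih1.trans ih2

variable [Fintype E]

theorem src_eq_tgt_of_sum_eq_zero {f : V → ℝ}
    (h : ∑ e, (f (Γ.src e) - f (Γ.tgt e)) * (f (Γ.src e) - f (Γ.tgt e)) / Γ.len e = 0) (e : E) :
    f (Γ.src e) = f (Γ.tgt e) := by
  have h1 := (Finset.sum_eq_zero_iff_of_nonneg (fun e _ =>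
    div_nonneg (mul_self_nonneg _) (Γ.len_pos e).le)).1 h e (Finset.mem_univ e)
  rw [div_eq_zero_iff, or_iff_left (Γ.len_pos e).ne', mul_self_eq_zero, sub_eq_zero] at h1
  exact h1

theorem IsOptimal.adjacencyMatrix_src_tgt (hΓ : Γ.IsOptimal) (e : E) :
    Γ.adjacencyMatrix (Γ.src e) (Γ.tgt e) = 1 / Γ.len e := by
  classical
  rw [adjacencyMatrix, Matrix.of_apply, if_neg (hΓ.no_loop e), Finset.sum_eq_single e]
  · simp
  · intro e' _ hne
    rw [if_neg]
    intro h
    exact hne (hΓ.no_multiple _ _ (Sym2.eq_iff.2 h))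
  · simp

theorem adjacencyMatrix_symm (p q : V) : Γ.adjacencyMatrix p q = Γ.adjacencyMatrix q p := by
  classical
  simp only [adjacencyMatrix, Matrix.of_apply]
  refine if_congr eq_comm rfl (Finset.sum_congr rfl fun e _ => if_congr or_comm rfl rfl)

variable [Fintype V]

theorem IsOptimal.discreteLaplacian_src_tgt (hΓ : Γ.IsOptimal) (e : E) :
    Γ.discreteLaplacian (Γ.src e) (Γ.tgt e) = -(1 / Γ.len e) := by
  classical
  rw [discreteLaplacian, Matrix.sub_apply, Matrix.diagonal_apply_ne _ (hΓ.no_loop e),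
    hΓ.adjacencyMatrix_src_tgt, zero_sub]

theorem discreteLaplacian_transpose : Γ.discreteLaplacian.transpose = Γ.discreteLaplacian := by
  classical
  rw [discreteLaplacian, Matrix.transpose_sub, Matrix.diagonal_transpose]
  congr 1
  ext p q
  exact adjacencyMatrix_symm q p

theorem discreteLaplacian_mulVec_eq_sum_adjacencyMatrix (f : V → ℝ) (p : V) :
    (Γ.discreteLaplacian *ᵥ f) p = ∑ s, Γ.adjacencyMatrix p s * (f p - f s) := by
  classical
  simp only [discreteLaplacian, Matrix.sub_mulVec, Pi.sub_apply, mul_sub, Finset.sum_sub_distrib,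
    ← Finset.sum_mul]
  congr 1
  convert Matrix.mulVec_diagonal (fun p => ∑ s, Γ.adjacencyMatrix p s) f p

-- A row sum over vertices becomes a sum over edges, the shape in which slopes at a vertex appear.
-- Without loops, an edge has `p` as at most one of its two ends.
open Classical in
theorem IsOptimal.discreteLaplacian_mulVec (hΓ : Γ.IsOptimal) (f : V → ℝ) (p : V) :
    (Γ.discreteLaplacian *ᵥ f) p =
      ∑ e, ((if Γ.src e = p then (f (Γ.src e) - f (Γ.tgt e)) / Γ.len e else 0) +
        (if Γ.tgt e = p then (f (Γ.tgt e) - f (Γ.src e)) / Γ.len e else 0)) := by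
  rw [discreteLaplacian_mulVec_eq_sum_adjacencyMatrix]
  have h1 : ∀ s, Γ.adjacencyMatrix p s * (f p - f s) =
      ∑ e, ((if Γ.src e = p ∧ Γ.tgt e = s then (f p - f s) / Γ.len e else 0) +
        (if Γ.tgt e = p ∧ Γ.src e = s then (f p - f s) / Γ.len e else 0)) := by
    intro s
    rw [adjacencyMatrix, Matrix.of_apply]
    by_cases hps : p = s
    · subst hps; simp
    rw [if_neg hps, Finset.sum_mul]
    refine Finset.sum_congr rfl fun e _ => ?_
    have := hΓ.no_loop e
    by_cases ha : Γ.src e = p ∧ Γ.tgt e = s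
    · have hb : ¬ (Γ.tgt e = p ∧ Γ.src e = s) := fun hb => this (ha.1.trans hb.1.symm)
      rw [if_pos (Or.inl ha), if_pos ha, if_neg hb]; ring
    · by_cases hb : Γ.tgt e = p ∧ Γ.src e = s
      · rw [if_pos (Or.inr hb.symm), if_neg ha, if_pos hb]; ring
      · rw [if_neg (not_or.2 ⟨ha, fun h => hb h.symm⟩), if_neg ha, if_neg hb]; ring
  simp only [h1]
  rw [Finset.sum_comm]
  refine Finset.sum_congr rfl fun e _ => ?_
  rw [Finset.sum_add_distrib]
  congr 1
  · by_cases h : Γ.src e = p <;> simp [h]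
  · by_cases h : Γ.tgt e = p <;> simp [h]

/-- Summation by parts: this is the Dirichlet form. With `f = g` it shows that the kernel of the
Laplacian consists of constants, by connectedness. -/
theorem IsOptimal.sum_mul_discreteLaplacian_mulVec (hΓ : Γ.IsOptimal) (f g : V → ℝ) :
    ∑ p, g p * (Γ.discreteLaplacian *ᵥ f) p =
      ∑ e, (g (Γ.src e) - g (Γ.tgt e)) * (f (Γ.src e) - f (Γ.tgt e)) / Γ.len e := by
  classical
  simp only [hΓ.discreteLaplacian_mulVec, Finset.mul_sum]
  rw [Finset.sum_comm]
  refine Finset.sum_congr rfl fun e _ => ?_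
  simp only [mul_add, Finset.sum_add_distrib, mul_ite, mul_zero, Finset.sum_ite_eq,
    Finset.mem_univ, if_true]
  ring

theorem IsOptimal.eq_of_discreteLaplacian_mulVec_eq_zero (hΓ : Γ.IsOptimal) {f : V → ℝ}
    (hf : Γ.discreteLaplacian *ᵥ f = 0) (p q : V) : f p = f q := by
  refine Γ.eq_of_forall_src_eq_tgt (src_eq_tgt_of_sum_eq_zero ?_) p q
  rw [← hΓ.sum_mul_discreteLaplacian_mulVec, hf]; simp

theorem discreteLaplacian_mulVec_const (c : ℝ) :
    Γ.discreteLaplacian *ᵥ (fun _ => c) = 0 := by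
  ext p
  simp [discreteLaplacian_mulVec_eq_sum_adjacencyMatrix]

variable {P : Matrix V V ℝ}

/-- As the Laplacian is symmetric, the transpose of `P` satisfies the same Penrose conditions;
uniqueness concludes. -/
theorem transpose_of_isMoorePenroseInverse (hP : Γ.discreteLaplacian.IsMoorePenroseInverse P) :
    P.transpose = P := by
  have hL := Γ.discreteLaplacian_transpose
  refine Matrix.IsMoorePenroseInverse.unique (A := Γ.discreteLaplacian) ⟨?_, ?_, ?_, ?_⟩ hP
  · have := congrArg Matrix.transpose hP.mul_mul_self
    simpa [Matrix.transpose_mul, hL, Matrix.mul_assoc] using this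
  · have := congrArg Matrix.transpose hP.mul_mul_inverse
    simpa [Matrix.transpose_mul, hL, Matrix.mul_assoc] using this
  · have := hP.transpose_right
    rw [Matrix.transpose_mul, hL] at this
    rw [Matrix.transpose_mul, hL, Matrix.transpose_transpose, this]
  · have := hP.transpose_left
    rw [Matrix.transpose_mul, hL] at this
    rw [Matrix.transpose_mul, hL, Matrix.transpose_transpose, this]

theorem pseudoInverse_symm (hP : Γ.discreteLaplacian.IsMoorePenroseInverse P) (p q : V) :
    P p q = P q p :=
  congrFun (congrFun (transpose_of_isMoorePenroseInverse hP) q) p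

theorem mul_comm_of_isMoorePenroseInverse (hP : Γ.discreteLaplacian.IsMoorePenroseInverse P) :
    P * Γ.discreteLaplacian = Γ.discreteLaplacian * P := by
  have := hP.transpose_left
  rwa [Matrix.transpose_mul, discreteLaplacian_transpose,
    transpose_of_isMoorePenroseInverse hP] at this

-- The matrix `M = 1 - L * P` is the orthogonal projection onto the kernel of `L`, the constants.
-- Concretely, its columns lie in that kernel, symmetry makes its rows constant too, and it fixes
-- the vector of ones, so each entry is `1/v`.
open Classical in
theorem IsOptimal.discreteLaplacian_mul_pseudoInverse_apply (hΓ : Γ.IsOptimal)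
    (hP : Γ.discreteLaplacian.IsMoorePenroseInverse P) (p q : V) :
    (Γ.discreteLaplacian * P) p q = (if p = q then 1 else 0) - 1 / Fintype.card V := by
  set L := Γ.discreteLaplacian with hL
  let M : Matrix V V ℝ := 1 - L * P
  have hM : L * M = 0 := by
    simp only [M]
    rw [Matrix.mul_sub, Matrix.mul_one, ← mul_comm_of_isMoorePenroseInverse hP,
      ← Matrix.mul_assoc, hP.mul_mul_self, sub_self]
  have hMt : M.transpose = M := by
    simp only [M]
    rw [Matrix.transpose_sub, Matrix.transpose_one, hP.transpose_left]
  have hcol : ∀ p p' q, M p q = M p' q := fun p p' q => by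
    refine hΓ.eq_of_discreteLaplacian_mulVec_eq_zero (f := fun p => M p q) ?_ p p'
    ext r
    exact congrFun (congrFun hM r) q
  have hrow : ∀ p q q', M p q = M p q' := fun p q q' => by
    have h1 : ∀ a b, M a b = M b a := fun a b => congrFun (congrFun hMt b) a
    rw [h1 p q, h1 p q']; exact hcol _ _ _
  have hsum : ∑ r, M p r = 1 := by
    have h1 : M *ᵥ (fun _ => (1 : ℝ)) = fun _ => 1 := by
      simp only [M]
      rw [Matrix.sub_mulVec, Matrix.one_mulVec, ← mul_comm_of_isMoorePenroseInverse hP,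
        ← Matrix.mulVec_mulVec, discreteLaplacian_mulVec_const, Matrix.mulVec_zero, sub_zero]
    simpa [Matrix.mulVec, dotProduct] using congrFun h1 p
  have hc : (Fintype.card V : ℝ) ≠ 0 := by
    have := Γ.nonempty
    exact_mod_cast Fintype.card_ne_zero
  have h2 : M p q = 1 / Fintype.card V := by
    rw [Finset.sum_congr rfl fun r _ => hrow p r q] at hsum
    simp only [Finset.sum_const, Finset.card_univ, nsmul_eq_mul] at hsum
    rw [eq_div_iff hc, mul_comm, hsum]
  have h3 : M p q = (if p = q then 1 else 0) - (L * P) p q := by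
    simp only [M, Matrix.sub_apply, Matrix.one_apply]
  rw [h3] at h2
  linarith

theorem pseudoInverse_mulVec_const (hP : Γ.discreteLaplacian.IsMoorePenroseInverse P) (c : ℝ) :
    P *ᵥ (fun _ => c) = 0 := by
  -- `P` commutes with the Laplacian, so `P = P L P = P² L`, and `P` kills what the Laplacian kills.
  have h : P = P * P * Γ.discreteLaplacian := by
    rw [Matrix.mul_assoc, mul_comm_of_isMoorePenroseInverse hP, ← Matrix.mul_assoc,
      hP.mul_mul_inverse]
  rw [h, ← Matrix.mulVec_mulVec, discreteLaplacian_mulVec_const, Matrix.mulVec_zero]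

end MetrizedGraph

/-! ### The Green function and the existence of voltages. -/

theorem eventually_min_eq_nhdsGE (t a : ℝ) : ∀ᶠ s in 𝓝[≥] t,
    min s a = min t a + (if t < a then 1 else 0) * (s - t) := by
  by_cases h : t < a
  · filter_upwards [Ico_mem_nhdsGE h] with s hs
    rw [min_eq_left hs.2.le, min_eq_left h.le, if_pos h]; ring
  · filter_upwards [self_mem_nhdsWithin] with s hs
    have h1 := not_lt.1 h
    rw [min_eq_right (h1.trans hs), min_eq_right h1, if_neg h]; ring

/-- The test is `t ≤ a` on the left but `t < a` on the right; the discrepancy at `t = a` is the unit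
drop in slope that produces a Dirac mass. -/
theorem eventually_min_eq_nhdsLE (t a : ℝ) : ∀ᶠ s in 𝓝[≤] t,
    min s a = min t a + (if t ≤ a then 1 else 0) * (s - t) := by
  by_cases h : t ≤ a
  · filter_upwards [self_mem_nhdsWithin] with s hs
    rw [min_eq_left (le_trans hs h), min_eq_left h, if_pos h]; ring
  · have h1 := not_le.1 h
    filter_upwards [Ioc_mem_nhdsLE h1] with s hs
    rw [min_eq_right hs.1.le, min_eq_right h1.le, if_neg h]; ring

theorem eventually_min_eq_nhds {t a : ℝ} (hta : t ≠ a) : ∀ᶠ s in 𝓝 t,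
    min s a = min t a + (if t < a then 1 else 0) * (s - t) := by
  rw [← nhdsLE_sup_nhdsGE t, eventually_sup]
  refine ⟨?_, eventually_min_eq_nhdsGE t a⟩
  simp only [show t < a ↔ t ≤ a from ⟨le_of_lt, fun h => lt_of_le_of_ne h hta⟩]
  exact eventually_min_eq_nhdsLE t a

namespace MetrizedGraph

variable {V E : Type*} {Γ : MetrizedGraph V E}

/-- As `t > 0`, the default value `0` of `coord` off the edge causes no false coincidence. -/
theorem coord_eq_iff {e : E} {t : ℝ} (ht : t ∈ Ioo 0 (Γ.len e)) (y : Γ.Point) :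
    t = Γ.coord e y ↔ Point.inner e t ht = y := by
  constructor
  · intro h
    cases y with
    | vertex p => exact absurd h ht.1.ne'
    | inner e' s hs =>
      by_cases he : e' = e
      · subst he
        have : t = s := by simpa [coord] using h
        subst this; rfl
      · exact absurd (by simpa [coord, he] using h) ht.1.ne'
  · rintro rfl
    simp [coord]

theorem clamp_eventually_nhdsGE {e : E} {t : ℝ} (ht : t ∈ Ico 0 (Γ.len e)) :
    ∀ᶠ s in 𝓝[≥] t, Γ.clamp e s = s := by
  filter_upwards [Ico_mem_nhdsGE ht.2] with s hs
  exact clamp_of_mem ⟨ht.1.trans hs.1, hs.2.le⟩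

theorem clamp_eventually_nhdsLE {e : E} {t : ℝ} (ht : t ∈ Ioc 0 (Γ.len e)) :
    ∀ᶠ s in 𝓝[≤] t, Γ.clamp e s = s := by
  filter_upwards [Ioc_mem_nhdsLE ht.1] with s hs
  exact clamp_of_mem ⟨hs.1.le, hs.2.trans ht.2⟩

theorem clamp_eventually_nhds {e : E} {t : ℝ} (ht : t ∈ Ioo 0 (Γ.len e)) :
    ∀ᶠ s in 𝓝 t, Γ.clamp e s = s := by
  filter_upwards [isOpen_Ioo.mem_nhds ht] with s hs
  exact clamp_of_mem (Ioo_subset_Icc_self hs)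

open Classical in
theorem finsum_smul_dirac {y z : Γ.Point} {σ : Γ.Point → ℝ}
    (hσ : ∀ p, σ p = (if p = z then 1 else 0) - (if p = y then 1 else 0)) :
    (∑ᶠ p, σ p • VectorMeasure.dirac p (1 : ℝ)) =
      (VectorMeasure.dirac z (1 : ℝ) - VectorMeasure.dirac y (1 : ℝ) : SignedMeasure Γ.Point) := by
  have h : ∀ p, σ p • VectorMeasure.dirac p (1 : ℝ) =
      ((if p = z then VectorMeasure.dirac p (1 : ℝ) else 0) -
        (if p = y then VectorMeasure.dirac p (1 : ℝ) else 0) : SignedMeasure Γ.Point) := fun p => by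
    rw [hσ]
    ext s hs
    split_ifs <;> simp
  have hs : ∀ w : Γ.Point, (Function.support fun p : Γ.Point =>
      (if p = w then VectorMeasure.dirac p (1 : ℝ) else 0 : SignedMeasure Γ.Point)) ⊆ {w} := by
    intro w p hp
    by_contra hne
    exact hp (if_neg hne)
  have hf : ∀ w : Γ.Point, ∑ᶠ p : Γ.Point,
      (if p = w then VectorMeasure.dirac p (1 : ℝ) else 0 : SignedMeasure Γ.Point) =
        VectorMeasure.dirac w 1 := fun w => by
    rw [finsum_eq_single _ w fun p hp => if_neg hp, if_pos rfl]
  rw [finsum_congr h, finsum_sub_distrib ((finite_singleton z).subset (hs z))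
    ((finite_singleton y).subset (hs y)), hf, hf]

variable [Fintype E]

theorem lengthMeasure_singleton (x : Γ.Point) : Γ.lengthMeasure {x} = 0 := by
  rw [lengthMeasure, Measure.finsetSum_apply]
  refine Finset.sum_eq_zero fun e _ => ?_
  rw [Measure.map_apply (Γ.measurable_path e) (measurableSet_singleton x),
    Measure.restrict_apply (Γ.measurable_path e (measurableSet_singleton x))]
  refine measure_mono_null (t := {Γ.coord e x}) ?_ (measure_singleton _)
  rintro s ⟨hs, hs'⟩
  rw [mem_singleton_iff, ← (show Γ.path e s = x from hs), coord_path e hs']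

instance : NullSingletonClass Γ.lengthMeasure := ⟨lengthMeasure_singleton⟩

theorem ae_path_of_ae_lengthMeasure {p : Γ.Point → Prop} (h : ∀ᵐ x ∂Γ.lengthMeasure, p x) (e : E) :
    ∀ᵐ s ∂volume.restrict (Ioo 0 (Γ.len e)), p (Γ.path e s) := by
  refine ae_of_ae_map (Γ.measurable_path e).aemeasurable ?_
  refine (Measure.absolutelyContinuous_of_le ?_).ae_le h
  exact Finset.single_le_sum (f := fun e => Measure.map (Γ.path e)
    (volume.restrict (Ioo 0 (Γ.len e)))) (fun _ _ => Measure.zero_le _) (Finset.mem_univ e)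

/-- A Green function: `Δ_x green x y = δ_y - ν`, with `ν` equidistributed over the vertices, when
`P` is the pseudo-inverse of the discrete Laplacian. -/
noncomputable def green (Γ : MetrizedGraph V E) (P : Matrix V V ℝ) (x y : Γ.Point) : ℝ :=
  Γ.interp (fun p => Γ.interp (fun q => P p q) y) x + Γ.bump x y

/-- Along an edge the difference is piecewise affine, and its only possible breaks inside the edge
are at the coordinates of `y` and `z`. -/
theorem green_path_sub_green_path (P : Matrix V V ℝ) (e : E) (s : ℝ) (y z : Γ.Point) :
    let c := fun p => Γ.interp (fun q => P p q) y - Γ.interp (fun q => P p q) z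
    Γ.green P (Γ.path e s) y - Γ.green P (Γ.path e s) z =
      c (Γ.src e) + ((c (Γ.tgt e) - c (Γ.src e)) / Γ.len e - Γ.coord e y / Γ.len e
        + Γ.coord e z / Γ.len e) * Γ.clamp e s
        + min (Γ.clamp e s) (Γ.coord e y) - min (Γ.clamp e s) (Γ.coord e z) := by
  simp only [green, interp_path, bump_path]
  ring

theorem continuous_green (P : Matrix V V ℝ) (y : Γ.Point) : Continuous fun x => Γ.green P x y :=
  (continuous_interp _).add (continuous_bump y)

section Slopes

variable (P : Matrix V V ℝ) (y z : Γ.Point) (k : ℝ)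

/-- The slope along `e`, at its end, of a difference of Green functions. -/
noncomputable def endSlope (Γ : MetrizedGraph V E) (P : Matrix V V ℝ) (y z : Γ.Point) (e : E) : ℝ :=
  let c := fun p => Γ.interp (fun q => P p q) y - Γ.interp (fun q => P p q) z
  (c (Γ.tgt e) - c (Γ.src e)) / Γ.len e - Γ.coord e y / Γ.len e + Γ.coord e z / Γ.len e

theorem green_eventually_nhdsGE {e : E} {t : ℝ} (ht : t ∈ Ico 0 (Γ.len e)) :
    ∀ᶠ s in 𝓝[≥] t, Γ.green P (Γ.path e s) y - Γ.green P (Γ.path e s) z + k =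
      Γ.green P (Γ.path e t) y - Γ.green P (Γ.path e t) z + k +
      (Γ.endSlope P y z e + (if t < Γ.coord e y then 1 else 0)
        - (if t < Γ.coord e z then 1 else 0)) * (s - t) := by
  filter_upwards [clamp_eventually_nhdsGE ht, eventually_min_eq_nhdsGE t (Γ.coord e y),
    eventually_min_eq_nhdsGE t (Γ.coord e z)] with s h1 h2 h3
  rw [green_path_sub_green_path, green_path_sub_green_path, h1,
    clamp_of_mem (Ico_subset_Icc_self ht), h2, h3, endSlope]
  ring

theorem green_eventually_nhdsLE {e : E} {t : ℝ} (ht : t ∈ Ioc 0 (Γ.len e)) :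
    ∀ᶠ s in 𝓝[≤] t, Γ.green P (Γ.path e s) y - Γ.green P (Γ.path e s) z + k =
      Γ.green P (Γ.path e t) y - Γ.green P (Γ.path e t) z + k +
      (Γ.endSlope P y z e + (if t ≤ Γ.coord e y then 1 else 0)
        - (if t ≤ Γ.coord e z then 1 else 0)) * (s - t) := by
  filter_upwards [clamp_eventually_nhdsLE ht, eventually_min_eq_nhdsLE t (Γ.coord e y),
    eventually_min_eq_nhdsLE t (Γ.coord e z)] with s h1 h2 h3
  rw [green_path_sub_green_path, green_path_sub_green_path, h1,
    clamp_of_mem (Ioc_subset_Icc_self ht), h2, h3, endSlope]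
  ring

theorem green_eventually_nhds {e : E} {t : ℝ} (ht : t ∈ Ioo 0 (Γ.len e))
    (hy : Point.inner e t ht ≠ y) (hz : Point.inner e t ht ≠ z) :
    ∀ᶠ s in 𝓝 t, Γ.green P (Γ.path e s) y - Γ.green P (Γ.path e s) z + k =
      Γ.green P (Γ.path e t) y - Γ.green P (Γ.path e t) z + k +
      (Γ.endSlope P y z e + (if t < Γ.coord e y then 1 else 0)
        - (if t < Γ.coord e z then 1 else 0)) * (s - t) := by
  filter_upwards [clamp_eventually_nhds ht,
    eventually_min_eq_nhds (mt (coord_eq_iff ht y).1 hy),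
    eventually_min_eq_nhds (mt (coord_eq_iff ht z).1 hz)] with s h1 h2 h3
  rw [green_path_sub_green_path, green_path_sub_green_path, h1,
    clamp_of_mem (Ioo_subset_Icc_self ht), h2, h3, endSlope]
  ring

-- The left side is the sum of the outgoing slopes of `bump · y` at `p`. An edge Green function
-- carries the unit mass at `y` to the two ends of the edge, in proportions given by linear
-- interpolation.
open Classical in
theorem sum_boundary_eq (p : V) : ∑ e,
    ((if Γ.src e = p then (if 0 < Γ.coord e y then 1 else 0) - Γ.coord e y / Γ.len e else 0) +
      (if Γ.tgt e = p then Γ.coord e y / Γ.len e else 0)) =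
    Γ.interp (fun q => if p = q then 1 else 0) y - (if Point.vertex p = y then 1 else 0) := by
  cases y with
  | vertex q => simp [coord, interp]
  | inner e t ht =>
    rw [Finset.sum_eq_single e]
    · simp [coord, interp, ht.1, eq_comm (a := p)]
    · intro e' _ hne
      simp [coord, hne.symm]
    · simp

variable [Fintype V] {P}

open Classical in
theorem IsOptimal.discreteLaplacian_mulVec_interp (hΓ : Γ.IsOptimal)
    (hP : Γ.discreteLaplacian.IsMoorePenroseInverse P) (p : V) :
    (Γ.discreteLaplacian *ᵥ fun r => Γ.interp (fun q => P r q) y) p =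
      Γ.interp (fun q => if p = q then 1 else 0) y - 1 / Fintype.card V := by
  have h : ∀ q, (Γ.discreteLaplacian * P) p q = (if p = q then 1 else 0) - 1 / Fintype.card V :=
    fun q => hΓ.discreteLaplacian_mul_pseudoInverse_apply hP p q
  rw [← interp_const (Γ := Γ) (1 / (Fintype.card V : ℝ)) y, ← interp_sub]
  simp only [← h, Matrix.mul_apply, interp_sum, interp_const_mul]
  rfl

-- At an interior point only the breaks of `min` contribute. At a vertex, the flux of the edge Green
-- functions and the Laplacian of the interpolated columns of `P` both contain the interpolated unit
-- mass and cancel up to Dirac terms; the constants `1/v` cancel between `y` and `z`.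
open Classical in
theorem IsOptimal.slopeSum_green (hΓ : Γ.IsOptimal)
    (hP : Γ.discreteLaplacian.IsMoorePenroseInverse P) (x : Γ.Point) :
    Γ.slopeSum (fun x => Γ.green P x y - Γ.green P x z + k) x =
      (if x = z then 1 else 0) - (if x = y then 1 else 0) := by
  cases x with
  | inner e t ht =>
    simp only [slopeSum]
    rw [derivWithin_Ici_of_eventually (green_eventually_nhdsGE P y z k ⟨ht.1.le, ht.2⟩),
      derivWithin_Iic_of_eventually (green_eventually_nhdsLE P y z k ⟨ht.1, ht.2.le⟩)]
    simp only [← coord_eq_iff]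
    have h : ∀ a : ℝ, (if t ≤ a then (1 : ℝ) else 0) =
        (if t < a then 1 else 0) + (if t = a then 1 else 0) := fun a => by
      rcases lt_trichotomy t a with h | h | h
      · simp [h, h.le, h.ne]
      · simp [h]
      · simp [h.not_ge, h.not_gt, h.ne']
    rw [h, h]; ring
  | vertex p =>
    simp only [slopeSum]
    have h1 : ∀ e, derivWithin (fun s => Γ.green P (Γ.path e s) y - Γ.green P (Γ.path e s) z + k)
        (Ici 0) 0 = Γ.endSlope P y z e + (if 0 < Γ.coord e y then 1 else 0)
          - (if 0 < Γ.coord e z then 1 else 0) := fun e =>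
      derivWithin_Ici_of_eventually (green_eventually_nhdsGE P y z k ⟨le_rfl, Γ.len_pos e⟩)
    have h2 : ∀ e, derivWithin (fun s => Γ.green P (Γ.path e s) y - Γ.green P (Γ.path e s) z + k)
        (Iic (Γ.len e)) (Γ.len e) = Γ.endSlope P y z e := fun e => by
      rw [derivWithin_Iic_of_eventually (green_eventually_nhdsLE P y z k ⟨Γ.len_pos e, le_rfl⟩),
        if_neg (coord_mem e y).2.not_ge, if_neg (coord_mem e z).2.not_ge, add_zero, sub_zero]
    simp only [h1, h2]
    have h3 := hΓ.discreteLaplacian_mulVec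
      (fun r => Γ.interp (fun q => P r q) y - Γ.interp (fun q => P r q) z) p
    have h4 : (Γ.discreteLaplacian *ᵥ fun r =>
        Γ.interp (fun q => P r q) y - Γ.interp (fun q => P r q) z) p =
        Γ.interp (fun q => if p = q then 1 else 0) y -
          Γ.interp (fun q => if p = q then 1 else 0) z := by
      have h5 := hΓ.discreteLaplacian_mulVec_interp y hP p
      have h6 := hΓ.discreteLaplacian_mulVec_interp z hP p
      change (Γ.discreteLaplacian *ᵥ ((fun r => Γ.interp (fun q => P r q) y) -
        (fun r => Γ.interp (fun q => P r q) z))) p = _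
      rw [Matrix.mulVec_sub, Pi.sub_apply, h5, h6]; ring
    have h7 := sum_boundary_eq y p
    have h8 := sum_boundary_eq z p
    -- Splits the outgoing slopes at `p` into the flux of `bump · y`, minus that of `bump · z`,
    -- minus the edge terms of the discrete Laplacian of the vertex values.
    have h9 : ∀ e, ((if Γ.src e = p then Γ.endSlope P y z e + (if 0 < Γ.coord e y then 1 else 0)
          - (if 0 < Γ.coord e z then 1 else 0) else 0) -
        (if Γ.tgt e = p then Γ.endSlope P y z e else 0)) =
      ((if Γ.src e = p then (if 0 < Γ.coord e y then 1 else 0) - Γ.coord e y / Γ.len e else 0) +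
        (if Γ.tgt e = p then Γ.coord e y / Γ.len e else 0)) -
      ((if Γ.src e = p then (if 0 < Γ.coord e z then 1 else 0) - Γ.coord e z / Γ.len e else 0) +
        (if Γ.tgt e = p then Γ.coord e z / Γ.len e else 0)) -
      ((if Γ.src e = p then ((Γ.interp (fun q => P (Γ.src e) q) y -
          Γ.interp (fun q => P (Γ.src e) q) z) - (Γ.interp (fun q => P (Γ.tgt e) q) y -
          Γ.interp (fun q => P (Γ.tgt e) q) z)) / Γ.len e else 0) +
        (if Γ.tgt e = p then ((Γ.interp (fun q => P (Γ.tgt e) q) y -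
          Γ.interp (fun q => P (Γ.tgt e) q) z) - (Γ.interp (fun q => P (Γ.src e) q) y -
          Γ.interp (fun q => P (Γ.src e) q) z)) / Γ.len e else 0)) := fun e => by
      simp only [endSlope]
      by_cases hs : Γ.src e = p <;> by_cases ht : Γ.tgt e = p <;>
        simp only [hs, ht, if_true, if_false] <;> ring
    rw [Finset.sum_congr rfl fun e _ => h9 e, Finset.sum_sub_distrib, Finset.sum_sub_distrib,
      h7, h8, ← h3, h4]
    ring

theorem IsOptimal.isVoltage_green (hΓ : Γ.IsOptimal)
    (hP : Γ.discreteLaplacian.IsMoorePenroseInverse P) :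
    Γ.IsVoltage z y fun x =>
      Γ.green P x y - Γ.green P x z + (Γ.green P z z - Γ.green P z y) := by
  set k := Γ.green P z z - Γ.green P z y
  have hae : Γ.secondDeriv (fun x => Γ.green P x y - Γ.green P x z + k)
      =ᵐ[Γ.lengthMeasure] 0 := by
    have hn : Γ.lengthMeasure ({y, z} : Set Γ.Point) = 0 := (toFinite _).measure_zero _
    filter_upwards [measure_eq_zero_iff_ae_notMem.1 hn] with x hx
    simp only [mem_insert_iff, mem_singleton_iff, not_or] at hx
    cases x with
    | vertex p => rfl
    | inner e t ht =>
      exact iteratedDeriv_two_of_eventually_affine (green_eventually_nhds P y z k ht hx.1 hx.2)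
  refine ⟨⟨((continuous_green P y).sub (continuous_green P z)).add continuous_const,
    ⟨range Point.vertex ∪ {y, z}, (finite_range _).union (toFinite _),
      fun p => Or.inl ⟨p, rfl⟩, fun e t ht hS => ?_⟩,
    (integrable_zero _ _ _).congr hae.symm⟩, ?_, by simp only [k]; ring⟩
  · simp only [mem_union, mem_insert_iff, mem_singleton_iff, not_or] at hS
    exact contDiffAt_of_eventually_affine (green_eventually_nhds P y z k ht hS.2.1 hS.2.2)
  · rw [laplacian, finsum_smul_dirac (hΓ.slopeSum_green y z k hP), WithDensityᵥEq.congr_ae hae,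
      withDensityᵥ_zero]
    simp

end Slopes

end MetrizedGraph

/-! ### Uniqueness of voltages. -/

namespace MetrizedGraph

variable {V E : Type*} [Fintype E] {Γ : MetrizedGraph V E}

theorem slopeSum_inner_eq_zero {f : Γ.Point → ℝ} {e : E} {t : ℝ} {ht : t ∈ Ioo 0 (Γ.len e)}
    (h : DifferentiableAt ℝ (fun s => f (Γ.path e s)) t) : Γ.slopeSum f (.inner e t ht) = 0 := by
  simp only [slopeSum]
  rw [h.derivWithin (uniqueDiffWithinAt_Ici t), h.derivWithin (uniqueDiffWithinAt_Iic t), sub_self]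

/-- Needed for the `finsum` in `laplacian` to be a genuine sum rather than its default value `0`. -/
theorem Zh.finite_support_slopeSum {f : Γ.Point → ℝ} (hf : Γ.Zh f) :
    (Function.support (Γ.slopeSum f)).Finite := by
  obtain ⟨S, hS, hV, hC⟩ := hf.2.1
  refine hS.subset fun x hx => ?_
  by_contra hxS
  cases x with
  | vertex p => exact hxS (hV p)
  | inner e t ht =>
    exact hx (slopeSum_inner_eq_zero ((hC e t ht hxS).differentiableAt (by norm_num)))

/-- The part with density has no atoms. Evaluating `Δ f` at single points therefore recovers every
slope sum from the measure equation. -/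
theorem Zh.laplacian_singleton {f : Γ.Point → ℝ} (hf : Γ.Zh f) (x : Γ.Point) :
    Γ.laplacian f {x} = -Γ.slopeSum f x := by
  have h1 : Γ.lengthMeasure.withDensityᵥ (Γ.secondDeriv f) {x} = 0 := by
    rw [withDensityᵥ_apply hf.2.2 (measurableSet_singleton x),
      Measure.restrict_zero_set (lengthMeasure_singleton x), integral_zero_measure]
  have h2 : (∑ᶠ p, Γ.slopeSum f p • VectorMeasure.dirac p (1 : ℝ) : SignedMeasure Γ.Point) {x} =
      Γ.slopeSum f x := by
    have hsub : (Function.support fun p => (Γ.slopeSum f p • VectorMeasure.dirac p (1 : ℝ) :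
        SignedMeasure Γ.Point)) ⊆ hf.finite_support_slopeSum.toFinset := by
      intro p hp
      rw [Finite.coe_toFinset, Function.mem_support]
      intro h
      exact hp (by simp [h])
    rw [finsum_eq_sum_of_support_subset _ hsub, FunLike.coe_sum, Finset.sum_apply,
      Finset.sum_eq_single x]
    · simp
    · intro p _ hne
      rw [_root_.smul_apply, VectorMeasure.dirac_apply_of_notMem (by simpa using hne),
        smul_zero]
    · intro hx
      rw [Finite.mem_toFinset, Function.notMem_support] at hx
      simp [hx]
  rw [laplacian, _root_.sub_apply, _root_.neg_apply, h1, h2, neg_zero, zero_sub]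

open Classical in
theorem IsVoltage.slopeSum_eq {z y : Γ.Point} {f : Γ.Point → ℝ} (hf : Γ.IsVoltage z y f)
    (x : Γ.Point) : Γ.slopeSum f x = (if x = z then 1 else 0) - (if x = y then 1 else 0) := by
  have h := hf.zh.laplacian_singleton x
  have hd : ∀ w : Γ.Point, (VectorMeasure.dirac w (1 : ℝ) : SignedMeasure Γ.Point) {x} =
      if x = w then 1 else 0 := fun w => by
    by_cases hw : x = w
    · subst hw; simp
    · rw [if_neg hw, VectorMeasure.dirac_apply_of_notMem (by simpa using Ne.symm hw)]
  rw [hf.laplacian_eq, _root_.sub_apply, hd, hd] at h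
  linarith

theorem IsVoltage.secondDeriv_ae_eq_zero {z y : Γ.Point} {f : Γ.Point → ℝ}
    (hf : Γ.IsVoltage z y f) : Γ.secondDeriv f =ᵐ[Γ.lengthMeasure] 0 := by
  classical
  refine hf.zh.2.2.ae_eq_of_withDensityᵥ_eq (integrable_zero _ _ _) ?_
  have h := hf.laplacian_eq
  rw [laplacian, finsum_smul_dirac hf.slopeSum_eq] at h
  rw [withDensityᵥ_zero]
  have h2 : -Γ.lengthMeasure.withDensityᵥ (Γ.secondDeriv f) = 0 := by
    rw [← sub_add_cancel (-Γ.lengthMeasure.withDensityᵥ (Γ.secondDeriv f))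
      (VectorMeasure.dirac z 1 - VectorMeasure.dirac y 1), h]
    abel
  exact neg_eq_zero.1 h2

theorem IsVoltage.affine_path {z y : Γ.Point} {f : Γ.Point → ℝ} (hf : Γ.IsVoltage z y f) (e : E) :
    (∀ t ∈ Ico 0 (Γ.len e), RightAffineAt (fun s => f (Γ.path e s)) t) ∧
      ∀ t ∈ Ioc 0 (Γ.len e), LeftAffineAt (fun s => f (Γ.path e s)) t := by
  obtain ⟨S, hS, hV, hC⟩ := hf.zh.2.1
  have hc : Continuous fun s => f (Γ.path e s) := hf.zh.1.comp (Γ.continuous_path e)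
  have hC' : ∀ t ∈ Ioo 0 (Γ.len e), t ∉ Γ.coord e '' S →
      ContDiffAt ℝ 2 (fun s => f (Γ.path e s)) t := fun t ht htS =>
    hC e t ht fun h => htS ⟨_, h, by simp [coord]⟩
  have hae : ∀ᵐ s ∂volume.restrict (Ioo 0 (Γ.len e)),
      iteratedDeriv 2 (fun s => f (Γ.path e s)) s = 0 := by
    filter_upwards [ae_path_of_ae_lengthMeasure hf.secondDeriv_ae_eq_zero e,
      ae_restrict_mem measurableSet_Ioo] with s h1 h2
    rw [path_of_mem h2] at h1
    exact h1
  have h0 : ∀ t ∈ Ioo 0 (Γ.len e), t ∉ Γ.coord e '' S →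
      iteratedDeriv 2 (fun s => f (Γ.path e s)) t = 0 := fun t ht htS =>
    iteratedDeriv_two_eq_zero_of_ae ht (hC' t ht htS) hae
  exact ⟨fun t ht => rightAffineAt_of_finite hc (hS.image _) hC' h0 ht,
    fun t ht => leftAffineAt_of_finite hc (hS.image _) hC' h0 ht⟩

/-- Both functions are piecewise affine with the same jumps of slope, so their difference is affine
on each edge with zero total slope at each vertex. Such a function has zero energy, hence is
constant, and it vanishes at `z`. -/
theorem IsVoltage.unique [Fintype V] {z y : Γ.Point} {f g : Γ.Point → ℝ}
    (hf : Γ.IsVoltage z y f) (hg : Γ.IsVoltage z y g) : f = g := by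
  classical
  have hE : ∀ e, ∃ c : ℝ,
      (∀ s ∈ Icc 0 (Γ.len e), f (Γ.path e s) - g (Γ.path e s) =
        f (Γ.path e 0) - g (Γ.path e 0) + c * s) ∧
      derivWithin (fun s => f (Γ.path e s)) (Ici 0) 0 -
        derivWithin (fun s => g (Γ.path e s)) (Ici 0) 0 = c ∧
      derivWithin (fun s => f (Γ.path e s)) (Iic (Γ.len e)) (Γ.len e) -
        derivWithin (fun s => g (Γ.path e s)) (Iic (Γ.len e)) (Γ.len e) = c := fun e =>
    exists_slope_sub (hf.zh.1.comp (Γ.continuous_path e)) (hg.zh.1.comp (Γ.continuous_path e))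
      (Γ.len_pos e) (hf.affine_path e).1 (hf.affine_path e).2 (hg.affine_path e).1
      (hg.affine_path e).2 fun t ht => by
        have h1 := hf.slopeSum_eq (.inner e t ht)
        rw [← hg.slopeSum_eq (.inner e t ht)] at h1
        exact h1
  choose c hc hc0 hcL using hE
  let h : V → ℝ := fun p => f (.vertex p) - g (.vertex p)
  have hslope : ∀ e, h (Γ.tgt e) = h (Γ.src e) + c e * Γ.len e := fun e => by
    have := hc e (Γ.len e) ⟨(Γ.len_pos e).le, le_rfl⟩
    rwa [path_of_len_le le_rfl, path_of_nonpos le_rfl] at this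
  have hv : ∀ p, ∑ e, ((if Γ.src e = p then c e else 0) - (if Γ.tgt e = p then c e else 0)) = 0 :=
    fun p => by
      have h1 := hf.slopeSum_eq (.vertex p)
      rw [← hg.slopeSum_eq (.vertex p), ← sub_eq_zero] at h1
      simp only [slopeSum] at h1
      rw [← Finset.sum_sub_distrib] at h1
      rw [← h1]
      refine Finset.sum_congr rfl fun e _ => ?_
      have h2 := hc0 e
      have h3 := hcL e
      by_cases hs : Γ.src e = p <;> by_cases ht : Γ.tgt e = p <;>
        simp only [hs, ht, if_true, if_false] <;> linarith
  -- The energy is obtained by multiplying the balance `hv` at `p` by `h p` and summing over `p`.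
  have hsum : ∑ e, (h (Γ.src e) - h (Γ.tgt e)) * (h (Γ.src e) - h (Γ.tgt e)) / Γ.len e = 0 := by
    have h1 : ∑ p, h p * ∑ e, ((if Γ.src e = p then c e else 0) -
        (if Γ.tgt e = p then c e else 0)) = 0 := by simp [hv]
    simp only [Finset.mul_sum] at h1
    rw [Finset.sum_comm] at h1
    simp only [mul_sub, Finset.sum_sub_distrib, mul_ite, mul_zero, Finset.sum_ite_eq,
      Finset.mem_univ, if_true] at h1
    rw [← neg_eq_zero, ← h1, ← Finset.sum_sub_distrib, ← Finset.sum_neg_distrib]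
    refine Finset.sum_congr rfl fun e _ => ?_
    have hL := (Γ.len_pos e).ne'
    rw [hslope e]
    field_simp
    ring
  have hedge : ∀ e, h (Γ.src e) = h (Γ.tgt e) := src_eq_tgt_of_sum_eq_zero hsum
  have hce : ∀ e, c e = 0 := fun e => by
    have h1 := hslope e
    rw [← hedge e] at h1
    have h2 : c e * Γ.len e = 0 := by linarith
    exact (mul_eq_zero.1 h2).resolve_right (Γ.len_pos e).ne'
  obtain ⟨p₀⟩ := Γ.nonempty
  have hconst : ∀ x, f x - g x = h p₀ := fun x => by
    cases x with
    | vertex p => exact Γ.eq_of_forall_src_eq_tgt hedge p p₀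
    | inner e t ht =>
      have h1 := hc e t (Ioo_subset_Icc_self ht)
      rw [path_of_mem ht, path_of_nonpos le_rfl, hce e, zero_mul, add_zero] at h1
      rw [h1]
      exact Γ.eq_of_forall_src_eq_tgt hedge (Γ.src e) p₀
  have h0 : h p₀ = 0 := by rw [← hconst z, hf.reference, hg.reference, sub_self]
  funext x
  have := hconst x
  rw [h0] at this
  linarith

theorem IsOptimal.voltage_eq [Fintype V] (hΓ : Γ.IsOptimal) {P : Matrix V V ℝ}
    (hP : Γ.discreteLaplacian.IsMoorePenroseInverse P) (z x y : Γ.Point) :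
    Γ.voltage z x y = Γ.green P x y - Γ.green P x z + (Γ.green P z z - Γ.green P z y) := by
  have hex : ∃ f, Γ.IsVoltage z y f := ⟨_, hΓ.isVoltage_green y z hP⟩
  rw [voltage, dif_pos hex]
  exact congrFun (hex.choose_spec.unique (hΓ.isVoltage_green y z hP)) x

end MetrizedGraph

/-! ### Integration against signed measures. -/

namespace MeasureTheory.SignedMeasure

variable {α : Type*} [MeasurableSpace α]

instance (μ : SignedMeasure α) : IsFiniteMeasure μ.variation := by
  rw [← totalVariation_eq_variation, totalVariation]
  infer_instance

theorem integrable_of_bounded (μ : SignedMeasure α) {f : α → ℝ} (hf : Measurable f) {C : ℝ}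
    (hC : ∀ x, |f x| ≤ C) : VectorMeasure.Integrable μ f :=
  Integrable.of_bound hf.aestronglyMeasurable C (ae_of_all _ hC)

theorem integral_eq_sub (μ : SignedMeasure α) {f : α → ℝ} (hf : Measurable f) {C : ℝ}
    (hC : ∀ x, |f x| ≤ C) :
    ∫ᵛ x, f x ∂•μ = ∫ x, f x ∂μ.toJordanDecomposition.posPart -
      ∫ x, f x ∂μ.toJordanDecomposition.negPart := by
  -- `integral_toSignedMeasure` uses the flipped pairing, which for real scalars is the same map.
  have hflip : (ContinuousLinearMap.lsmul ℝ ℝ : ℝ →L[ℝ] ℝ →L[ℝ] ℝ) =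
      (ContinuousLinearMap.lsmul ℝ ℝ : ℝ →L[ℝ] ℝ →L[ℝ] ℝ).flip := by
    ext; simp
  have h := μ.toSignedMeasure_toJordanDecomposition
  rw [JordanDecomposition.toSignedMeasure] at h
  rw [← VectorMeasure.integral_toSignedMeasure, ← VectorMeasure.integral_toSignedMeasure, ← hflip,
    ← VectorMeasure.integral_sub_vectorMeasure (integrable_of_bounded _ hf hC)
      (integrable_of_bounded _ hf hC), h]

/-- Jordan decomposition reduces this to Fubini for four pairs of finite measures; boundedness gives
all integrability. -/
theorem integral_integral_swap (μ ν : SignedMeasure α) {F : α → α → ℝ}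
    (hF : Measurable fun z : α × α => F z.1 z.2) {C : ℝ} (hC : ∀ x y, |F x y| ≤ C) :
    ∫ᵛ x, (∫ᵛ y, F x y ∂•μ) ∂•ν = ∫ᵛ y, (∫ᵛ x, F x y ∂•ν) ∂•μ := by
  have hF1 : ∀ x, Measurable (F x) := fun x => hF.comp (by fun_prop : Measurable fun y => (x, y))
  have hF2 : ∀ y, Measurable fun x => F x y := fun y =>
    hF.comp (by fun_prop : Measurable fun x => (x, y))
  have hint : ∀ (m n : Measure α) [IsFiniteMeasure m] [IsFiniteMeasure n],
      Integrable (Function.uncurry F) (m.prod n) := fun m n _ _ =>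
    Integrable.of_bound hF.aestronglyMeasurable C (ae_of_all _ fun z => hC z.1 z.2)
  have hm1 : ∀ (m : Measure α) [IsFiniteMeasure m], Measurable fun x => ∫ y, F x y ∂m :=
    fun m _ => (hF.stronglyMeasurable.integral_prod_right' (ν := m)).measurable
  have hm2 : ∀ (m : Measure α) [IsFiniteMeasure m], Measurable fun y => ∫ x, F x y ∂m :=
    fun m _ => (hF.stronglyMeasurable.integral_prod_left' (μ := m)).measurable
  have hb1 : ∀ (m : Measure α) [IsFiniteMeasure m] (x : α), |∫ y, F x y ∂m| ≤ C * m.real univ :=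
    fun m _ x => norm_integral_le_of_norm_le_const (μ := m) (f := F x) (C := C) (ae_of_all _ (hC x))
  have hb2 : ∀ (m : Measure α) [IsFiniteMeasure m] (y : α), |∫ x, F x y ∂m| ≤ C * m.real univ :=
    fun m _ y => norm_integral_le_of_norm_le_const (μ := m) (f := fun x => F x y) (C := C)
      (ae_of_all _ fun x => hC x y)
  have key : ∀ (m n : Measure α) [IsFiniteMeasure m] [IsFiniteMeasure n],
      ∫ x, ∫ y, F x y ∂m ∂n = ∫ y, ∫ x, F x y ∂n ∂m := fun m n _ _ =>
    MeasureTheory.integral_integral_swap (hint n m)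
  have hi1 : ∀ (m n : Measure α) [IsFiniteMeasure m] [IsFiniteMeasure n],
      Integrable (fun x => ∫ y, F x y ∂m) n := fun m n _ _ =>
    Integrable.of_bound (hm1 m).aestronglyMeasurable _ (ae_of_all _ (hb1 m))
  have hi2 : ∀ (m n : Measure α) [IsFiniteMeasure m] [IsFiniteMeasure n],
      Integrable (fun y => ∫ x, F x y ∂m) n := fun m n _ _ =>
    Integrable.of_bound (hm2 m).aestronglyMeasurable _ (ae_of_all _ (hb2 m))
  have e1 : ∀ x, ∫ᵛ y, F x y ∂•μ = ∫ y, F x y ∂μ.toJordanDecomposition.posPart -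
      ∫ y, F x y ∂μ.toJordanDecomposition.negPart := fun x => integral_eq_sub μ (hF1 x) (hC x)
  have e2 : ∀ y, ∫ᵛ x, F x y ∂•ν = ∫ x, F x y ∂ν.toJordanDecomposition.posPart -
      ∫ x, F x y ∂ν.toJordanDecomposition.negPart := fun y =>
    integral_eq_sub ν (hF2 y) fun x => hC x y
  have e3 := integral_eq_sub ν (f := fun x => ∫ y, F x y ∂μ.toJordanDecomposition.posPart -
    ∫ y, F x y ∂μ.toJordanDecomposition.negPart) ((hm1 _).sub (hm1 _))
    (fun x => (abs_sub _ _).trans (add_le_add (hb1 _ x) (hb1 _ x)))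
  have e4 := integral_eq_sub μ (f := fun y => ∫ x, F x y ∂ν.toJordanDecomposition.posPart -
    ∫ x, F x y ∂ν.toJordanDecomposition.negPart) ((hm2 _).sub (hm2 _))
    (fun y => (abs_sub _ _).trans (add_le_add (hb2 _ y) (hb2 _ y)))
  simp only [e1, e2]
  rw [e3, e4]
  rw [integral_sub (hi1 _ _) (hi1 _ _), integral_sub (hi1 _ _) (hi1 _ _),
    integral_sub (hi2 _ _) (hi2 _ _), integral_sub (hi2 _ _) (hi2 _ _),
    key, key, key, key]
  ring

end MeasureTheory.SignedMeasure

/-! ### Effective resistance and independence of the canonical constant. -/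

namespace MetrizedGraph

variable {V E : Type*} {Γ : MetrizedGraph V E}

/-- Separates the variables, which gives measurability of `green` on the product. -/
theorem interp_eq_sum [Fintype V] [DecidableEq V] (f : V → ℝ) (x : Γ.Point) :
    Γ.interp f x = ∑ p, f p * Γ.interp (Pi.single p 1) x := by
  simp only [← interp_const_mul, ← interp_sum]
  congr 1
  funext q
  simp [Pi.single_apply]

theorem measurable_interp (f : V → ℝ) : Measurable (Γ.interp f) :=
  (continuous_interp f).measurable

variable [Fintype E]

theorem green_comm {P : Matrix V V ℝ} (hP : ∀ p q, P p q = P q p) (x y : Γ.Point) :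
    Γ.green P x y = Γ.green P y x := by
  rw [green, green, interp_comm (fun p q => P p q), bump_comm]
  simp only [hP]

variable [Fintype V]

theorem measurable_green (P : Matrix V V ℝ) :
    Measurable fun z : Γ.Point × Γ.Point => Γ.green P z.1 z.2 := by
  classical
  have h := fun f => Γ.measurable_interp f
  refine Measurable.add ?_ measurable_bump
  simp only [interp_eq_sum (fun p => Γ.interp (fun q => P p q) _)]
  fun_prop

theorem abs_green_le (P : Matrix V V ℝ) (x y : Γ.Point) :
    |Γ.green P x y| ≤ ∑ p, ∑ q, |P p q| + ∑ e, 2 * Γ.len e := by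
  refine (abs_add_le _ _).trans (add_le_add (abs_interp_le (fun p => abs_interp_le (fun q => ?_) y) x)
    (abs_bump_le x y))
  exact (Finset.single_le_sum (f := fun q => |P p q|) (fun _ _ => abs_nonneg _)
    (Finset.mem_univ q)).trans (Finset.single_le_sum (f := fun p => ∑ q, |P p q|)
      (fun _ _ => Finset.sum_nonneg fun _ _ => abs_nonneg _) (Finset.mem_univ p))

/-- The effective resistance between two points, in terms of a Green function. -/
noncomputable def resistance (Γ : MetrizedGraph V E) (P : Matrix V V ℝ) (x y : Γ.Point) : ℝ :=
  Γ.green P x x + Γ.green P y y - 2 * Γ.green P x y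

theorem measurable_green_diag (P : Matrix V V ℝ) : Measurable fun x : Γ.Point => Γ.green P x x :=
  (measurable_green P).comp (by fun_prop : Measurable fun x : Γ.Point => (x, x))

theorem measurable_resistance (P : Matrix V V ℝ) :
    Measurable fun z : Γ.Point × Γ.Point => Γ.resistance P z.1 z.2 :=
  (((measurable_green_diag P).comp measurable_fst).add
    ((measurable_green_diag P).comp measurable_snd)).sub ((measurable_green P).const_mul 2)

theorem abs_resistance_le (P : Matrix V V ℝ) (x y : Γ.Point) :
    |Γ.resistance P x y| ≤ 4 * (∑ p, ∑ q, |P p q| + ∑ e, 2 * Γ.len e) := by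
  have h1 := abs_le.1 (abs_green_le P x x)
  have h2 := abs_le.1 (abs_green_le P y y)
  have h3 := abs_le.1 (abs_green_le P x y)
  rw [resistance, abs_le]
  constructor <;> linarith [h1.1, h1.2, h2.1, h2.2, h3.1, h3.2]

variable {P : Matrix V V ℝ}

theorem IsOptimal.voltageAvg_self (hΓ : Γ.IsOptimal)
    (hP : Γ.discreteLaplacian.IsMoorePenroseInverse P) (μ : SignedMeasure Γ.Point) (x : Γ.Point) :
    Γ.voltageAvg μ x x = ∫ᵛ ζ, Γ.resistance P x ζ ∂•μ := by
  have h : ∀ ζ, Γ.voltage ζ x x = Γ.resistance P x ζ := fun ζ => by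
    rw [hΓ.voltage_eq hP, green_comm (pseudoInverse_symm hP) ζ x, resistance]; ring
  simp only [voltageAvg, h]

/-- Resistance is symmetric, so integrating it against `μ` and `ν` in the two orders gives `c` and
`d`. Thus the tau constant is well defined without uniqueness of the canonical measure. -/
theorem IsOptimal.const_eq_of_voltageAvg_eq (hΓ : Γ.IsOptimal) {μ ν : SignedMeasure Γ.Point}
    (hμ : μ univ = 1) (hν : ν univ = 1) {c d : ℝ} (hc : ∀ x, Γ.voltageAvg μ x x = c)
    (hd : ∀ x, Γ.voltageAvg ν x x = d) : c = d := by
  have hP := Γ.discreteLaplacian.isMoorePenroseInverse_pseudoInverse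
  set P := Γ.discreteLaplacian.pseudoInverse
  have h := SignedMeasure.integral_integral_swap μ ν (measurable_resistance (Γ := Γ) P)
    (abs_resistance_le P)
  have hsymm : ∀ x y, Γ.resistance P x y = Γ.resistance P y x := fun x y => by
    rw [resistance, resistance, green_comm (pseudoInverse_symm hP) x y]; ring
  have h1 : ∀ x, ∫ᵛ y, Γ.resistance P x y ∂•μ = c := fun x => by
    rw [← hΓ.voltageAvg_self hP, hc]
  have h2 : ∀ y, ∫ᵛ x, Γ.resistance P x y ∂•ν = d := fun y => by
    simp only [hsymm _ y]
    rw [← hΓ.voltageAvg_self hP, hd]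
  simp only [h1, h2, VectorMeasure.integral_const, hμ, hν] at h
  simpa using h

end MetrizedGraph

/-! ### Integrals over edges and measures with masses and edge densities. -/

theorem integral_affine_interp (L a b : ℝ) (hL : 0 < L) :
    ∫ s in (0 : ℝ)..L, ((1 - s / L) * a + s / L * b) = L * (a + b) / 2 := by
  have h : ∀ s : ℝ, (1 - s / L) * a + s / L * b = a + (b - a) / L * s := fun s => by
    field_simp; ring
  simp only [h]
  rw [intervalIntegral.integral_add (by simp) (Continuous.intervalIntegrable (by fun_prop) _ _),
    intervalIntegral.integral_const_mul, integral_id, intervalIntegral.integral_const]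
  simp only [smul_eq_mul]
  field_simp
  ring

theorem integral_mul_sub (L : ℝ) : ∫ s in (0 : ℝ)..L, s * (L - s) = L ^ 3 / 6 := by
  have h : ∀ s : ℝ, s * (L - s) = L * s - s ^ 2 := fun s => by ring
  simp only [h]
  rw [intervalIntegral.integral_sub (Continuous.intervalIntegrable (by fun_prop) _ _)
    (Continuous.intervalIntegrable (by fun_prop) _ _), intervalIntegral.integral_const_mul,
    integral_id, integral_pow]
  norm_num
  ring

theorem integral_min_sub_mul {L t : ℝ} (hL : 0 < L) (ht0 : 0 ≤ t) (htL : t ≤ L) :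
    ∫ s in (0 : ℝ)..L, (min s t - s * t / L) = t * (L - t) / 2 := by
  have h1 : ∫ s in (0 : ℝ)..t, min s t = t ^ 2 / 2 := by
    rw [intervalIntegral.integral_congr (g := fun s => s), integral_id]
    · ring
    · intro s hs
      rw [uIcc_of_le ht0] at hs
      exact min_eq_left hs.2
  have h2 : ∫ s in t..L, min s t = (L - t) * t := by
    rw [intervalIntegral.integral_congr (g := fun _ => t), intervalIntegral.integral_const,
      smul_eq_mul]
    intro s hs
    rw [uIcc_of_le htL] at hs
    exact min_eq_right hs.1
  have hi : ∀ a b : ℝ, IntervalIntegrable (fun s => min s t) volume a b := fun a b =>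
    Continuous.intervalIntegrable (by fun_prop) _ _
  rw [intervalIntegral.integral_sub (hi _ _) (Continuous.intervalIntegrable (by fun_prop) _ _),
    ← intervalIntegral.integral_add_adjacent_intervals (hi 0 t) (hi t L), h1, h2,
    intervalIntegral.integral_div, intervalIntegral.integral_mul_const, integral_id]
  field_simp
  ring

namespace MetrizedGraph

variable {V E : Type*} {Γ : MetrizedGraph V E}

/-- Lebesgue measure along one edge. -/
noncomputable def edgeMeasure (Γ : MetrizedGraph V E) (e : E) : Measure Γ.Point :=
  Measure.map (Γ.path e) (volume.restrict (Ioo 0 (Γ.len e)))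

instance (Γ : MetrizedGraph V E) (e : E) : IsFiniteMeasure (Γ.edgeMeasure e) := by
  unfold edgeMeasure
  infer_instance

/-- The signed measure with masses `m` at the vertices and density `κ` along the edges. -/
noncomputable def weightedMeasure [Fintype V] [Fintype E] (Γ : MetrizedGraph V E) (m : V → ℝ)
    (κ : E → ℝ) : SignedMeasure Γ.Point :=
  ∑ p, m p • VectorMeasure.dirac (.vertex p) (1 : ℝ) + ∑ e, κ e • (Γ.edgeMeasure e).toSignedMeasure

theorem integral_edgeMeasure {f : Γ.Point → ℝ} (hf : Measurable f) (e : E) :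
    ∫ᵛ x, f x ∂•(Γ.edgeMeasure e).toSignedMeasure =
      ∫ s in Ioo 0 (Γ.len e), f (Γ.path e s) := by
  have hflip : (ContinuousLinearMap.lsmul ℝ ℝ : ℝ →L[ℝ] ℝ →L[ℝ] ℝ) =
      (ContinuousLinearMap.lsmul ℝ ℝ : ℝ →L[ℝ] ℝ →L[ℝ] ℝ).flip := by
    ext; simp
  rw [hflip, VectorMeasure.integral_toSignedMeasure, edgeMeasure,
    integral_map (Γ.measurable_path e).aemeasurable hf.aestronglyMeasurable]

variable [Fintype V] [Fintype E]

theorem integral_weightedMeasure (m : V → ℝ) (κ : E → ℝ) {f : Γ.Point → ℝ} (hf : Measurable f)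
    {C : ℝ} (hC : ∀ x, |f x| ≤ C) {g : E → ℝ → ℝ}
    (hg : ∀ e, ∀ s ∈ Ioo 0 (Γ.len e), f (Γ.path e s) = g e s) :
    ∫ᵛ x, f x ∂•(Γ.weightedMeasure m κ) =
      ∑ p, m p * f (.vertex p) + ∑ e, κ e * ∫ s in (0 : ℝ)..Γ.len e, g e s := by
  have hi : ∀ μ : SignedMeasure Γ.Point, VectorMeasure.Integrable μ f := fun μ =>
    SignedMeasure.integrable_of_bounded μ hf hC
  rw [weightedMeasure, VectorMeasure.integral_add_vectorMeasure (hi _) (hi _),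
    VectorMeasure.integral_finsetSum_vectorMeasure fun _ _ => hi _,
    VectorMeasure.integral_finsetSum_vectorMeasure fun _ _ => hi _]
  congr 1
  · refine Finset.sum_congr rfl fun p _ => ?_
    rw [VectorMeasure.integral_smul_vectorMeasure, VectorMeasure.integral_dirac]
    simp
  · refine Finset.sum_congr rfl fun e _ => ?_
    rw [VectorMeasure.integral_smul_vectorMeasure, integral_edgeMeasure hf, smul_eq_mul,
      intervalIntegral.integral_of_le (Γ.len_pos e).le, integral_Ioc_eq_integral_Ioo,
      setIntegral_congr_fun measurableSet_Ioo (hg e)]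

end MetrizedGraph

/-! ### The explicit canonical measure and its constant. -/

namespace MetrizedGraph

variable {V E : Type*} {Γ : MetrizedGraph V E}

/-- The effective resistance between the end points of an edge. -/
def edgeResistance (Γ : MetrizedGraph V E) (P : Matrix V V ℝ) (e : E) : ℝ :=
  P (Γ.src e) (Γ.src e) - 2 * P (Γ.src e) (Γ.tgt e) + P (Γ.tgt e) (Γ.tgt e)

/-- The density of the canonical measure along an edge. -/
noncomputable def canonicalDensity (Γ : MetrizedGraph V E) (P : Matrix V V ℝ) (e : E) : ℝ :=
  1 / Γ.len e - Γ.edgeResistance P e / Γ.len e ^ 2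

theorem abs_interp_le_sum [Fintype V] (c : V → ℝ) (x : Γ.Point) : |Γ.interp c x| ≤ ∑ p, |c p| :=
  abs_interp_le (fun p => Finset.single_le_sum (f := fun p => |c p|) (fun _ _ => abs_nonneg _)
    (Finset.mem_univ p)) x

theorem card_ne_zero [Fintype V] (Γ : MetrizedGraph V E) : (Fintype.card V : ℝ) ≠ 0 := by
  have := Γ.nonempty
  exact_mod_cast Fintype.card_ne_zero

variable [Fintype E]

open Classical in
/-- The mass of the canonical measure at a vertex. -/
noncomputable def canonicalMass (Γ : MetrizedGraph V E) (p : V) : ℝ :=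
  1 - (1 / 2) * ∑ e, ((if Γ.src e = p then 1 else 0) + (if Γ.tgt e = p then 1 else 0))

/-- The function on `Γ` that vanishes at the vertices and has second derivative `-2 κ e` along the
edge `e`. -/
noncomputable def quad (Γ : MetrizedGraph V E) (κ : E → ℝ) (x : Γ.Point) : ℝ :=
  ∑ e, κ e * (Γ.coord e x * (Γ.len e - Γ.coord e x))

theorem quad_vertex (κ : E → ℝ) (p : V) : Γ.quad κ (.vertex p) = 0 := by
  have h : ∀ e, Γ.coord e (.vertex p) = 0 := fun _ => rfl
  simp [quad, h]

theorem quad_path (κ : E → ℝ) {e : E} {s : ℝ} (hs : s ∈ Ioo 0 (Γ.len e)) :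
    Γ.quad κ (Γ.path e s) = κ e * (s * (Γ.len e - s)) := by
  rw [quad, Finset.sum_eq_single e, coord_path e hs]
  · intro e' _ hne
    simp [coord_path_of_ne hne.symm]
  · simp

theorem measurable_quad (κ : E → ℝ) : Measurable (Γ.quad κ) := by
  have := fun e => Γ.measurable_coord e
  unfold quad
  fun_prop

theorem abs_quad_le (κ : E → ℝ) (x : Γ.Point) : |Γ.quad κ x| ≤ ∑ e, |κ e| * Γ.len e ^ 2 := by
  refine (Finset.abs_sum_le_sum_abs _ _).trans (Finset.sum_le_sum fun e _ => ?_)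
  have hx := coord_mem e x
  rw [abs_mul]
  refine mul_le_mul_of_nonneg_left ?_ (abs_nonneg _)
  rw [abs_of_nonneg (mul_nonneg hx.1 (sub_nonneg.2 hx.2.le)), sq]
  exact mul_le_mul hx.2.le (by linarith [hx.1]) (sub_nonneg.2 hx.2.le) (Γ.len_pos e).le

/-- At coordinate `t`, bilinear interpolation falls short of the affine interpolation of the
diagonal by `R t (len - t) / len²`, while the edge Green function adds `t (len - t) / len`. The net
coefficient is the canonical density. -/
theorem green_self {P : Matrix V V ℝ} (hP : ∀ p q, P p q = P q p) (x : Γ.Point) :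
    Γ.green P x x = Γ.interp (fun p => P p p) x + Γ.quad (Γ.canonicalDensity P) x := by
  cases x with
  | vertex p => rw [green, bump_vertex, quad_vertex]; rfl
  | inner e t ht =>
    have hL := (Γ.len_pos e).ne'
    rw [← path_of_mem ht, green, bump_path, quad_path _ ht, coord_path e ht]
    simp only [interp_path, clamp_of_mem (Ioo_subset_Icc_self ht), canonicalDensity,
      edgeResistance, min_self, hP (Γ.tgt e) (Γ.src e)]
    field_simp
    ring

variable [Fintype V]

theorem integral_quad_weightedMeasure (m : V → ℝ) (κ κ' : E → ℝ) :
    ∫ᵛ x, Γ.quad κ' x ∂•(Γ.weightedMeasure m κ) = ∑ e, κ e * κ' e * Γ.len e ^ 3 / 6 := by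
  rw [integral_weightedMeasure m κ (measurable_quad κ') (abs_quad_le κ')
    (g := fun e s => κ' e * (s * (Γ.len e - s))) fun e s hs => quad_path κ' hs]
  simp only [quad_vertex, mul_zero, Finset.sum_const_zero, zero_add,
    intervalIntegral.integral_const_mul, integral_mul_sub]
  exact Finset.sum_congr rfl fun e _ => by ring

theorem integral_bump_weightedMeasure (m : V → ℝ) (κ : E → ℝ) (y : Γ.Point) :
    ∫ᵛ x, Γ.bump x y ∂•(Γ.weightedMeasure m κ) = Γ.quad κ y / 2 := by
  rw [integral_weightedMeasure m κ (continuous_bump y).measurable (fun x => abs_bump_le x y)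
    (g := fun e s => min s (Γ.coord e y) - s * Γ.coord e y / Γ.len e) fun e s hs => by
      rw [bump_path, clamp_of_mem (Ioo_subset_Icc_self hs)]]
  simp only [bump_vertex, mul_zero, Finset.sum_const_zero, zero_add, quad, Finset.sum_div]
  refine Finset.sum_congr rfl fun e _ => ?_
  have hy := coord_mem e y
  rw [integral_min_sub_mul (Γ.len_pos e) hy.1 hy.2.le]
  ring

variable {P : Matrix V V ℝ}

-- On an edge from `p` to `q`, the resistance is `2 (P p p - P p q) - (P p p - P q q)`. Summing over
-- the edges at `p` with weights `1/len` compares the Laplacian of the column `p` of `P`, known to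
-- be `1 - 1/v` at `p`, with the Laplacian of the diagonal.
open Classical in
theorem IsOptimal.discreteLaplacian_mulVec_diag (hΓ : Γ.IsOptimal)
    (hP : Γ.discreteLaplacian.IsMoorePenroseInverse P) (p : V) :
    1 / Fintype.card V + (1 / 2) * (Γ.discreteLaplacian *ᵥ fun p => P p p) p =
      1 - (1 / 2) * ∑ e, ((if Γ.src e = p then Γ.edgeResistance P e / Γ.len e else 0) +
        (if Γ.tgt e = p then Γ.edgeResistance P e / Γ.len e else 0)) := by
  have h1 := hΓ.discreteLaplacian_mul_pseudoInverse_apply hP p p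
  have h2 : (Γ.discreteLaplacian * P) p p = (Γ.discreteLaplacian *ᵥ fun r => P r p) p := rfl
  rw [if_pos rfl, h2, hΓ.discreteLaplacian_mulVec] at h1
  have h3 : ∑ e, ((if Γ.src e = p then Γ.edgeResistance P e / Γ.len e else 0) +
        (if Γ.tgt e = p then Γ.edgeResistance P e / Γ.len e else 0)) =
      2 * (1 - 1 / Fintype.card V) - (Γ.discreteLaplacian *ᵥ fun p => P p p) p := by
    rw [← h1, hΓ.discreteLaplacian_mulVec, Finset.mul_sum, ← Finset.sum_sub_distrib]
    refine Finset.sum_congr rfl fun e _ => ?_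
    have hloop := hΓ.no_loop e
    have hsymm := pseudoInverse_symm hP (Γ.src e) (Γ.tgt e)
    by_cases hs : Γ.src e = p
    · have ht : Γ.tgt e ≠ p := fun ht => hloop (hs.trans ht.symm)
      simp only [if_pos hs, if_neg ht, edgeResistance]
      subst hs
      rw [hsymm]; ring
    · by_cases ht : Γ.tgt e = p
      · simp only [if_neg hs, if_pos ht, edgeResistance]
        subst ht
        ring
      · simp only [if_neg hs, if_neg ht]; ring
  rw [h3]; ring

/-- The canonical measure, in terms of the pseudo-inverse `P` of the discrete Laplacian. -/
noncomputable def explicitCanonicalMeasure (Γ : MetrizedGraph V E) (P : Matrix V V ℝ) :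
    SignedMeasure Γ.Point :=
  Γ.weightedMeasure Γ.canonicalMass (Γ.canonicalDensity P)

/-- Against edgewise affine functions, the measure acts like masses at the vertices. The density
gives each end of an edge half of `κ len = 1 - R / len`; the halves of `1` cancel the valence term
in `canonicalMass`, and `discreteLaplacian_mulVec_diag` rewrites the rest. -/
theorem IsOptimal.integral_interp (hΓ : Γ.IsOptimal)
    (hP : Γ.discreteLaplacian.IsMoorePenroseInverse P) (c : V → ℝ) :
    ∫ᵛ x, Γ.interp c x ∂•(Γ.explicitCanonicalMeasure P) =
      ∑ p, c p * (1 / Fintype.card V + (1 / 2) * (Γ.discreteLaplacian *ᵥ fun p => P p p) p) := by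
  classical
  have hswap : ∀ w : E → ℝ, ∑ p, c p * ∑ e, ((if Γ.src e = p then w e else 0) +
      (if Γ.tgt e = p then w e else 0)) = ∑ e, w e * (c (Γ.src e) + c (Γ.tgt e)) := fun w => by
    simp only [Finset.mul_sum]
    rw [Finset.sum_comm]
    refine Finset.sum_congr rfl fun e _ => ?_
    simp only [mul_add, Finset.sum_add_distrib, mul_ite, mul_zero, Finset.sum_ite_eq,
      Finset.mem_univ, if_true]
    ring
  rw [explicitCanonicalMeasure, integral_weightedMeasure _ _ (measurable_interp c)
    (abs_interp_le_sum c)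
    (g := fun e s => (1 - s / Γ.len e) * c (Γ.src e) + s / Γ.len e * c (Γ.tgt e)) fun e s hs => by
      rw [interp_path, clamp_of_mem (Ioo_subset_Icc_self hs)]]
  have h1 : ∀ p, Γ.canonicalMass p * Γ.interp c (.vertex p) = c p - (1 / 2) * (c p *
      ∑ e, ((if Γ.src e = p then 1 else 0) + (if Γ.tgt e = p then 1 else 0))) := fun p => by
    rw [canonicalMass, interp]; ring
  have h2 : ∀ p, c p * (1 / Fintype.card V +
      (1 / 2) * (Γ.discreteLaplacian *ᵥ fun p => P p p) p) = c p - (1 / 2) * (c p *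
      ∑ e, ((if Γ.src e = p then Γ.edgeResistance P e / Γ.len e else 0) +
        (if Γ.tgt e = p then Γ.edgeResistance P e / Γ.len e else 0))) := fun p => by
    rw [hΓ.discreteLaplacian_mulVec_diag hP]; ring
  simp only [h1, h2, integral_affine_interp _ _ _ (Γ.len_pos _), Finset.sum_sub_distrib,
    ← Finset.mul_sum]
  rw [hswap (fun _ => 1), hswap (fun e => Γ.edgeResistance P e / Γ.len e), sub_add,
    sub_right_inj, Finset.mul_sum, Finset.mul_sum, ← Finset.sum_sub_distrib]
  refine Finset.sum_congr rfl fun e _ => ?_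
  have hL := (Γ.len_pos e).ne'
  rw [canonicalDensity]
  field_simp
  ring

theorem IsOptimal.sum_discreteLaplacian_mulVec (hΓ : Γ.IsOptimal) (f : V → ℝ) :
    ∑ p, (Γ.discreteLaplacian *ᵥ f) p = 0 := by
  simpa using hΓ.sum_mul_discreteLaplacian_mulVec f (fun _ => 1)

theorem IsOptimal.explicitCanonicalMeasure_univ (hΓ : Γ.IsOptimal)
    (hP : Γ.discreteLaplacian.IsMoorePenroseInverse P) :
    Γ.explicitCanonicalMeasure P univ = 1 := by
  have h := hΓ.integral_interp hP (fun _ => 1)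
  simp only [interp_const, VectorMeasure.integral_const, one_mul, Finset.sum_add_distrib,
    ← Finset.mul_sum, hΓ.sum_discreteLaplacian_mulVec, Finset.sum_const, Finset.card_univ,
    nsmul_eq_mul, mul_zero, add_zero, mul_one_div, div_self Γ.card_ne_zero] at h
  simpa using h

/-- `P` annihilates the constant `1/v`, and `P L` subtracts from the diagonal of `P` its mean. -/
theorem IsOptimal.pseudoInverse_mulVec (hΓ : Γ.IsOptimal)
    (hP : Γ.discreteLaplacian.IsMoorePenroseInverse P) (r : V) :
    ∑ q, P q r * (1 / Fintype.card V + (1 / 2) * (Γ.discreteLaplacian *ᵥ fun p => P p p) q) =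
      P r r / 2 - P.trace / (2 * Fintype.card V) := by
  classical
  have h1 : ∑ q, P q r * (1 / Fintype.card V) = 0 := by
    have := congrFun (pseudoInverse_mulVec_const hP (1 / (Fintype.card V : ℝ))) r
    simp only [Matrix.mulVec, dotProduct, Pi.zero_apply] at this
    rw [← this]
    exact Finset.sum_congr rfl fun q _ => by rw [pseudoInverse_symm hP q r]
  have h2 : ∑ q, P q r * (Γ.discreteLaplacian *ᵥ fun p => P p p) q =
      P r r - P.trace / Fintype.card V := by
    have h3 : ∑ q, P q r * (Γ.discreteLaplacian *ᵥ fun p => P p p) q =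
        ((Γ.discreteLaplacian * P) *ᵥ fun p => P p p) r := by
      rw [← mul_comm_of_isMoorePenroseInverse hP, ← Matrix.mulVec_mulVec]
      change _ = ∑ q, P r q * (Γ.discreteLaplacian *ᵥ fun p => P p p) q
      exact Finset.sum_congr rfl fun q _ => by rw [pseudoInverse_symm hP q r]
    rw [h3]
    simp only [Matrix.mulVec, dotProduct, hΓ.discreteLaplacian_mul_pseudoInverse_apply hP, sub_mul,
      Finset.sum_sub_distrib, ite_mul, one_mul, zero_mul, Finset.sum_ite_eq, Finset.mem_univ,
      if_true, ← Finset.mul_sum, Matrix.trace, Matrix.diag_apply]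
    ring
  simp only [mul_add, Finset.sum_add_distrib, h1, zero_add, mul_left_comm _ (1 / 2 : ℝ),
    ← Finset.mul_sum, h2]
  have := Γ.card_ne_zero
  field_simp

/-- The decisive identity: twice this integral differs from `g(x,x)` by a constant. The interpolated
part reduces to `pseudoInverse_mulVec`, and the edge Green functions turn the density `κ` into half
of `quad κ`, matching `green_self`. -/
theorem IsOptimal.integral_green (hΓ : Γ.IsOptimal)
    (hP : Γ.discreteLaplacian.IsMoorePenroseInverse P) (x : Γ.Point) :
    ∫ᵛ ζ, Γ.green P x ζ ∂•(Γ.explicitCanonicalMeasure P) =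
      Γ.green P x x / 2 - P.trace / (2 * Fintype.card V) := by
  have hs := pseudoInverse_symm hP
  simp only [green_comm hs x]
  simp only [green]
  rw [VectorMeasure.integral_fun_add
    (SignedMeasure.integrable_of_bounded _ (measurable_interp _) (abs_interp_le_sum _))
    (SignedMeasure.integrable_of_bounded _ (continuous_bump x).measurable fun y => abs_bump_le y x),
    hΓ.integral_interp hP]
  rw [← green, green_self hs]
  have h1 := integral_bump_weightedMeasure Γ.canonicalMass (Γ.canonicalDensity P) x
  rw [← explicitCanonicalMeasure] at h1
  have h2 : ∑ q, Γ.interp (fun r => P q r) x * (1 / Fintype.card V +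
      (1 / 2) * (Γ.discreteLaplacian *ᵥ fun p => P p p) q) =
      Γ.interp (fun p => P p p) x / 2 - P.trace / (2 * Fintype.card V) := by
    have h3 : Γ.interp (fun p => P p p) x / 2 - P.trace / (2 * Fintype.card V) =
        Γ.interp (fun p => P p p / 2 - P.trace / (2 * Fintype.card V)) x := by
      rw [interp_sub, interp_const, div_eq_inv_mul, ← interp_const_mul]
      simp only [div_eq_inv_mul]
    rw [h3]
    simp only [← hΓ.pseudoInverse_mulVec hP, interp_sum]
    refine Finset.sum_congr rfl fun q _ => ?_
    rw [mul_comm, ← interp_const_mul]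
    simp only [mul_comm]
  rw [h1, h2]
  ring

theorem IsOptimal.voltageAvg_explicitCanonicalMeasure (hΓ : Γ.IsOptimal)
    (hP : Γ.discreteLaplacian.IsMoorePenroseInverse P) (x : Γ.Point) :
    Γ.voltageAvg (Γ.explicitCanonicalMeasure P) x x =
      2 * P.trace / Fintype.card V +
      (1 / 2) * ∑ p, P p p * (Γ.discreteLaplacian *ᵥ fun p => P p p) p +
      ∑ e, Γ.canonicalDensity P e * Γ.canonicalDensity P e * Γ.len e ^ 3 / 6 := by
  have hs := pseudoInverse_symm hP
  have hi : ∀ {f : Γ.Point → ℝ} {C : ℝ}, Measurable f → (∀ x, |f x| ≤ C) →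
    VectorMeasure.Integrable (Γ.explicitCanonicalMeasure P) f := fun hf hC =>
      SignedMeasure.integrable_of_bounded _ hf hC
  have hdiag : VectorMeasure.Integrable (Γ.explicitCanonicalMeasure P)
      fun ζ => Γ.green P ζ ζ := hi (measurable_green_diag P) fun ζ => abs_green_le P ζ ζ
  have hgr : VectorMeasure.Integrable (Γ.explicitCanonicalMeasure P)
      fun ζ => Γ.green P x ζ :=
    hi ((measurable_green P).comp (by fun_prop : Measurable fun ζ => (x, ζ))) fun ζ =>
      abs_green_le P x ζ
  have hconst : VectorMeasure.Integrable (Γ.explicitCanonicalMeasure P)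
      fun _ : Γ.Point => Γ.green P x x := hi measurable_const fun _ => le_rfl
  -- By `integral_green` the terms in `x` cancel, leaving this integral and one more `tr P / v`.
  have hd : ∫ᵛ ζ, Γ.green P ζ ζ ∂•(Γ.explicitCanonicalMeasure P) =
      P.trace / Fintype.card V +
      (1 / 2) * ∑ p, P p p * (Γ.discreteLaplacian *ᵥ fun p => P p p) p +
      ∑ e, Γ.canonicalDensity P e * Γ.canonicalDensity P e * Γ.len e ^ 3 / 6 := by
    simp only [green_self hs]
    rw [VectorMeasure.integral_fun_add (hi (measurable_interp _) (abs_interp_le_sum _))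
      (hi (measurable_quad _) (abs_quad_le _)), hΓ.integral_interp hP]
    congr 1
    · simp only [mul_add, Finset.sum_add_distrib, mul_left_comm _ (1 / 2 : ℝ), ← Finset.mul_sum,
        ← Finset.sum_div, Matrix.trace, Matrix.diag_apply, mul_one_div]
    · exact integral_quad_weightedMeasure _ _ _
  rw [hΓ.voltageAvg_self hP]
  simp only [resistance]
  have hsm : ∫ᵛ ζ, 2 * Γ.green P x ζ ∂•(Γ.explicitCanonicalMeasure P) =
      2 * ∫ᵛ ζ, Γ.green P x ζ ∂•(Γ.explicitCanonicalMeasure P) :=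
    VectorMeasure.integral_fun_smul _ _ (2 : ℝ) _
  have hadd : VectorMeasure.Integrable (Γ.explicitCanonicalMeasure P)
      fun ζ => Γ.green P x x + Γ.green P ζ ζ := hconst.add hdiag
  rw [VectorMeasure.integral_fun_sub hadd (hgr.const_mul 2),
    VectorMeasure.integral_fun_add hconst hdiag, hsm, hΓ.integral_green hP, hd,
    VectorMeasure.integral_const, hΓ.explicitCanonicalMeasure_univ hP]
  simp only [ContinuousLinearMap.lsmul_apply, smul_eq_mul]
  have := Γ.card_ne_zero
  field_simp
  ring

end MetrizedGraph

/-! ### The formulas for the tau constant. -/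

theorem mainTheorem1 {V E : Type*} [Fintype V] [Fintype E] (Γ : MetrizedGraph V E)
    (hΓ : Γ.IsOptimal) (L P : Matrix V V ℝ) (hL : L = Γ.discreteLaplacian)
    (hP : P = L.pseudoInverse) :
    Γ.IsCanonicalMeasure Γ.canonicalMeasure ∧
    Γ.tauConstant =
      -(1 / 12) * ∑ e, L (Γ.src e) (Γ.tgt e) *
          (1 / L (Γ.src e) (Γ.tgt e) + P (Γ.src e) (Γ.src e) - 2 * P (Γ.src e) (Γ.tgt e)
            + P (Γ.tgt e) (Γ.tgt e)) ^ 2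
        + (1 / 4) * ∑ q, ∑ s, L q s * P q q * P s s
        + (1 / (Fintype.card V : ℝ)) * P.trace ∧
    Γ.tauConstant =
      -(1 / 12) * ∑ e, L (Γ.src e) (Γ.tgt e) *
          (1 / L (Γ.src e) (Γ.tgt e) + P (Γ.src e) (Γ.src e) - 2 * P (Γ.src e) (Γ.tgt e)
            + P (Γ.tgt e) (Γ.tgt e)) ^ 2
        - (1 / 4) * ∑ e, L (Γ.src e) (Γ.tgt e) *
          (P (Γ.src e) (Γ.src e) - P (Γ.tgt e) (Γ.tgt e)) ^ 2
        + (1 / (Fintype.card V : ℝ)) * P.trace := by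
  subst hL
  have hMP : Γ.discreteLaplacian.IsMoorePenroseInverse P :=
    hP ▸ Γ.discreteLaplacian.isMoorePenroseInverse_pseudoInverse
  have havg := hΓ.voltageAvg_explicitCanonicalMeasure hMP
  have huniv := hΓ.explicitCanonicalMeasure_univ hMP
  have hex : ∃ μ, Γ.IsCanonicalMeasure μ := ⟨_, huniv, _, havg⟩
  have hcan : Γ.IsCanonicalMeasure Γ.canonicalMeasure := by
    rw [MetrizedGraph.canonicalMeasure, dif_pos hex]
    exact hex.choose_spec
  obtain ⟨c, hc⟩ := hcan.2
  have htau : Γ.tauConstant = (1 / 2) * c := by rw [MetrizedGraph.tauConstant, hc]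
  -- The chosen canonical measure may a priori differ from the explicit one; only their constants
  -- are identified.
  rw [hΓ.const_eq_of_voltageAvg_eq hcan.1 huniv hc havg] at htau
  have hD := hΓ.sum_mul_discreteLaplacian_mulVec (fun p => P p p) (fun p => P p p)
  -- With `l = -1/len` and `κ len² = len - R`, each term `l (1/l + R)²` equals `-κ² len³`.
  have h1 : ∑ e, Γ.discreteLaplacian (Γ.src e) (Γ.tgt e) *
      (1 / Γ.discreteLaplacian (Γ.src e) (Γ.tgt e) + P (Γ.src e) (Γ.src e)
        - 2 * P (Γ.src e) (Γ.tgt e) + P (Γ.tgt e) (Γ.tgt e)) ^ 2 =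
      -6 * ∑ e, Γ.canonicalDensity P e * Γ.canonicalDensity P e * Γ.len e ^ 3 / 6 := by
    rw [Finset.mul_sum]
    refine Finset.sum_congr rfl fun e _ => ?_
    have hL := (Γ.len_pos e).ne'
    rw [hΓ.discreteLaplacian_src_tgt, MetrizedGraph.canonicalDensity,
      MetrizedGraph.edgeResistance]
    field_simp
    ring
  have h2 : ∑ q, ∑ s, Γ.discreteLaplacian q s * P q q * P s s =
      ∑ p, P p p * (Γ.discreteLaplacian *ᵥ fun p => P p p) p := by
    simp only [Matrix.mulVec, dotProduct, Finset.mul_sum]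
    exact Finset.sum_congr rfl fun q _ => Finset.sum_congr rfl fun s _ => by ring
  -- The two formulas differ only in writing the Dirichlet form of the diagonal of `P` over vertices
  -- or over edges.
  have h3 : ∑ e, Γ.discreteLaplacian (Γ.src e) (Γ.tgt e) *
      (P (Γ.src e) (Γ.src e) - P (Γ.tgt e) (Γ.tgt e)) ^ 2 =
      -∑ p, P p p * (Γ.discreteLaplacian *ᵥ fun p => P p p) p := by
    rw [hD, ← Finset.sum_neg_distrib]
    refine Finset.sum_congr rfl fun e _ => ?_
    rw [hΓ.discreteLaplacian_src_tgt]
    ring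
  refine ⟨hcan, ?_, ?_⟩
  · rw [htau, h1, h2]; ring
  · rw [htau, h1, h3]; ring
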